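/- Fix integers $k\ge 1$ and $t\ge 1$. *Type A.* $NC^k(n)$ is the set of non-crossing partitions of $\{1,\dots,kn\}$ all of whose block sizes are multiples of $k$. *Type B.* Write $[\pm m]=\{1,\dots,m,-1,\dots,-m\}$. $NC^k(B_n)$ is the set of partitions $\pi$ of $[\pm kn]$ that are non-crossing for the order $1,2,\dots,kn,-1,-2,\dots,-kn$, such that $V\in\pi$ implies $-V\in\pi$, at most one block (the zero-block) satisfies $V=-V$, and all block sizes are multiples of $k$. *Type D.* Put $M=k(n-1)$ and consider an annulus with $1,\dots,M,-1,\dots,-M$ in clockwise order on the outer circle and $M+1,\dots,M+k,-(M+1),\dots,-(M+k)$ in counterclockwise order on the inner circle. A partition of $[\pm kn]$ is drawn by joining, for each block, its elements $e_1,\dots,e_l$ (first the outer ones in clockwise order, then the inner ones in counterclockwise order) cyclically by curves inside the annulus; it is non-crossing if this can be done so that the curves of different blocks do not meet. $NC^k(D_n)$ is the set of non-crossing partitions $\pi$ on this annulus such that (1) $V\in\pi$ implies $-V\in\pi$; (2) in the drawing, $|e_{i+1}|\equiv|e_i|+1 \pmod k$ for all $i$ and every block $\{e_1,\dots,e_l\}$,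 where $e_{l+1}=e_1$; (3) a zero-block $V=-V$ contains all labels on the inner circle and at least two labels on the outer circle; (4) if no block meets both circles, then for every inner block $V$ and every outer block $W$ that is visible from the inner circle (no other block separates it from the inner circle in the centrally symmetric drawing), the partition obtained by merging $V$ with $W$, and symmetrically $-V$ with $-W$, is again non-crossing on the annulus and satisfies (2). The size of an unordered pair $\{V,-V\}$ of blocks is $\tfrac12|V\cup(-V)|$ (so a zero-block counts as a pair of size $\tfrac12|V|$). Then, as $n\to\infty$ with $k$ and $t$ fixed, the expected number of block pairs of size $tk$ in a uniformly random partition from $NC^k(B_n)$ is asymptotically equivalent to $$\frac{nk^2}{(k+1)^{t+1}},$$ and the same holds for a uniformly random partition from $NC^k(D_n)$. This is the same behaviour as in type A: the expected number of blocks of size $tk$ in a uniformly random partition from $NC^k(n)$ is also asymptotically equivalent to $\dfrac{nk^2}{(k+1)^{t+1}}$. -/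

import Mathlib

open Filter Asymptotics
open scoped Pointwise BigOperators

/-- A family of blocks is non-crossing for the order given by the positions `pos`: whenever
`a < b < c < d` with `a, c` in one block and `b, d` in one block, the two blocks are equal. -/
def NonCrossing (pos : ℤ → ℕ) (B : Finset (Finset ℤ)) : Prop :=
  ∀ V ∈ B, ∀ W ∈ B, ∀ a ∈ V, ∀ b ∈ W, ∀ c ∈ V, ∀ d ∈ W,
    pos a < pos b → pos b < pos c → pos c < pos d → V = W

/-- `[±m] = {1, …, m, -1, …, -m}`. -/
noncomputable def signedSet (m : ℕ) : Finset ℤ := (Finset.Icc (-(m : ℤ)) m).erase 0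

/-- Position `0, …, 2m - 1` of a label on the circle labelled clockwise
`1, 2, …, m, -1, -2, …, -m`. -/
def circlePos (m : ℕ) (x : ℤ) : ℕ := if 0 < x then x.natAbs - 1 else m + x.natAbs - 1

/-! ### Type A -/

open Classical in
/-- `NC^k(n)`: the non-crossing partitions of `{1, …, kn}` all of whose block sizes are
multiples of `k`. -/
noncomputable def NCA (k n : ℕ) : Finset (Finpartition (Finset.Icc (1 : ℤ) (k * n : ℕ))) :=
  Finset.univ.filter fun π => NonCrossing Int.toNat π.parts ∧ ∀ V ∈ π.parts, k ∣ V.card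

/-- The number of blocks of size `s`. -/
def numBlocks {S : Finset ℤ} (π : Finpartition S) (s : ℕ) : ℕ :=
  (π.parts.filter fun V => V.card = s).card

/-! ### Type B -/

/-- Non-crossing partitions of type `B_m`: non-crossing partitions of `[±m]`, in the order
`1 < 2 < … < m < -1 < -2 < … < -m`, closed under `V ↦ -V` and with at most one zero-block
`V = -V`. -/
def IsNCB (m : ℕ) (π : Finpartition (signedSet m)) : Prop :=
  NonCrossing (circlePos m) π.parts ∧
  (∀ V ∈ π.parts, -V ∈ π.parts) ∧
  (∀ V ∈ π.parts, ∀ W ∈ π.parts, V = -V → W = -W → V = W)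

open Classical in
/-- `NC^k(B_n)`: the partitions of type `B_{kn}` all of whose block sizes are multiples of `k`.
(Halving the size of the zero-block would give the same set: the other blocks come in pairs
`V, -V` of equal size, so that `2k` divides the cardinality of the zero-block.) -/
noncomputable def NCB (k n : ℕ) : Finset (Finpartition (signedSet (k * n))) :=
  Finset.univ.filter fun π => IsNCB (k * n) π ∧ ∀ V ∈ π.parts, k ∣ V.card

/-- The number of unordered pairs `{V, -V}` of blocks of size `s`, where the size of the pair is
`|V ∪ -V| / 2`. A zero-block `V = -V` is a pair of size `|V| / 2`. -/
def numPairs {S : Finset ℤ} (π : Finpartition S) (s : ℕ) : ℕ :=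
  ((π.parts.filter fun V => (V ∪ -V).card = 2 * s).image
    fun V => ({V, -V} : Finset (Finset ℤ))).card

/-! ### Type D

The annulus has the labels `1, …, M, -1, …, -M` with `M = k (n - 1)` clockwise on the outer
circle and `M + 1, …, M + k, -(M + 1), …, -(M + k)` counterclockwise on the inner circle. -/

/-- Labels on the outer circle. -/
noncomputable def outerSet (k n : ℕ) : Finset ℤ := signedSet (k * (n - 1))

/-- Labels on the inner circle. -/
noncomputable def innerSet (k n : ℕ) : Finset ℤ := signedSet (k * n) \ outerSet k n

/-- Position `0, …, 2k - 1` of a label on the inner circle, counterclockwise. -/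
def innerPos (k n : ℕ) (x : ℤ) : ℕ :=
  if 0 < x then x.natAbs - k * (n - 1) - 1 else k + (x.natAbs - k * (n - 1)) - 1

/-- The order in which the labels are met on the boundary of the disk that is obtained by cutting
the annulus open along an arc joining the two circles: first the outer circle clockwise, then the
inner circle counterclockwise, each starting at the cut. The numbers `a` and `b` fix the ends of
the cut. -/
noncomputable def cutPos (k n a b : ℕ) (x : ℤ) : ℕ :=
  if x ∈ outerSet k n then (circlePos (k * (n - 1)) x + a) % (2 * (k * (n - 1)))
  else 2 * (k * (n - 1)) + (innerPos k n x + b) % (2 * k)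

/-- `y` is the cyclic successor of `x` in the block `V`, listed by increasing position
(for `V = {x}` it is `x` itself). -/
def IsNext (pos : ℤ → ℕ) (V : Finset ℤ) (x y : ℤ) : Prop :=
  x ∈ V ∧ y ∈ V ∧
  ((pos x < pos y ∧ ∀ z ∈ V, ¬ (pos x < pos z ∧ pos z < pos y)) ∨
    ((∀ z ∈ V, pos z ≤ pos x) ∧ ∀ z ∈ V, pos y ≤ pos z))

/-- The family of blocks `B` can be drawn in the annulus without crossings, in such a way that the
elements `e_1, …, e_t` of each block, in the cyclic order in which they are joined in the drawing
(outer elements clockwise, then inner elements counterclockwise), satisfy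
`|e_{i+1}| ≡ |e_i| + 1 (mod k)`, where `e_{t+1} = e_1`. A family is non-crossing on the annulus
when it is non-crossing on the disk that is left after cutting the annulus along a suitable arc
from the outer to the inner circle: such an arc can be drawn alongside a curve that joins an outer
element to an inner element of a block. -/
def AnnularDivisible (k n : ℕ) (B : Finset (Finset ℤ)) : Prop :=
  ∃ a b : ℕ, NonCrossing (cutPos k n a b) B ∧
    ∀ V ∈ B, ∀ x y, IsNext (cutPos k n a b) V x y → |y| ≡ |x| + 1 [ZMOD k]

/-- Clockwise distance from `x` to `y` on the outer circle. -/
def cwDist (k n : ℕ) (x y : ℤ) : ℕ :=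
  (circlePos (k * (n - 1)) y + (2 * (k * (n - 1)) - circlePos (k * (n - 1)) x)) %
    (2 * (k * (n - 1)))

/-- The outer block `W` lies between the outer block `V` and the inner circle (in the middle):
`V` lies inside an arc, shorter than half of the outer circle, that joins two elements of `W`. -/
def Shields (k n : ℕ) (W V : Finset ℤ) : Prop :=
  ∃ x ∈ W, ∃ y ∈ W, cwDist k n x y < k * (n - 1) ∧
    ∀ z ∈ V, 0 < cwDist k n x z ∧ cwDist k n x z < cwDist k n x y

/-- The outer block `V` is visible: no outer block lies between it and the inner circle. -/
def Visible (k n : ℕ) (B : Finset (Finset ℤ)) (V : Finset ℤ) : Prop :=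
  ∀ W ∈ B, W ⊆ outerSet k n → ¬ Shields k n W V

/-- The blocks after `V, W` have been replaced by `V ∪ W` and, symmetrically, `-V, -W` by
`-(V ∪ W)`. -/
def mergeBlocks (B : Finset (Finset ℤ)) (V W : Finset ℤ) : Finset (Finset ℤ) :=
  (B \ {V, -V, W, -W}) ∪ {V ∪ W, -(V ∪ W)}

/-- `k`-divisible non-crossing partitions of type `D_n`. -/
structure IsNCD (k n : ℕ) (π : Finpartition (signedSet (k * n))) : Prop where
  annular : AnnularDivisible k n π.parts
  neg_mem : ∀ V ∈ π.parts, -V ∈ π.parts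
  zero_block : ∀ V ∈ π.parts, V = -V → innerSet k n ⊆ V ∧ 2 ≤ (V ∩ outerSet k n).card
  merge : (∀ V ∈ π.parts, V ⊆ innerSet k n ∨ V ⊆ outerSet k n) →
    ∀ V ∈ π.parts, ∀ W ∈ π.parts, V ⊆ innerSet k n → W ⊆ outerSet k n →
      Visible k n π.parts W → AnnularDivisible k n (mergeBlocks π.parts V W)

open Classical in
/-- `NC^k(D_n)`. -/
noncomputable def NCD (k n : ℕ) : Finset (Finpartition (signedSet (k * n))) :=
  Finset.univ.filter fun π => IsNCD k n π

/-! ### Expectations for the uniform distribution -/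

/-- Expected number of blocks of size `s` of a uniformly random element of `NC^k(n)`. -/
noncomputable def expectedBlocksA (k n s : ℕ) : ℝ := 𝔼 π ∈ NCA k n, (numBlocks π s : ℝ)

/-- Expected number of block pairs of size `s` of a uniformly random element of `NC^k(B_n)`. -/
noncomputable def expectedPairsB (k n s : ℕ) : ℝ := 𝔼 π ∈ NCB k n, (numPairs π s : ℝ)

/-- Expected number of block pairs of size `s` of a uniformly random element of `NC^k(D_n)`. -/
noncomputable def expectedPairsD (k n s : ℕ) : ℝ := 𝔼 π ∈ NCD k n, (numPairs π s : ℝ)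

/-! A non-crossing partition of a line of m points is determined by the word of length and sum m
that records the size of each block at its first point and 0 elsewhere (`ker_eq_of_word_eq`). For a
k-divisible partition every entry is a multiple of k. The statistic counts the entries equal to tk,
so the theorem becomes a statement about random words.

Words of length kn whose entries, divided by k, sum to n behave like independent geometric variables
with P(i) = k/(k+1) · (k+1)^(-i). The expected proportion of entries tk is then `density k t`, and k
· `density k t` = k²/(k+1)^(t+1). Two estimates make this rigorous without exact enumeration. By the
cycle lemma and the mode of a binomial distribution, the number of ballot words is at least `growth
k` ^ n up to a polynomial factor (`growth_pow_le`). By an exponential tilt, the words whose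
proportion deviates by ε number at most `growth k` ^ n · exp(-cn) up to a constant, even if
boundedly many entries are not multiples of k (`card_deviation_le`). Polynomial losses are therefore
harmless: it is enough to inject ballot words into each family and to encode each family by almost
divisible words together with polynomially many further data (`isEquivalent_of_encoding`).

In types B and D the outer circle can be cut at two opposite places so that only a zero-block is
separated (`exists_isCut`). By symmetry, the word of one half determines the partition once the cut,
a point of the zero-block and, in type D, a representative of the block of each inner label are
known (`exists_encoding`). Only the zero-block and the blocks that meet the inner circle can spoil
divisibility or the count. Conversely, a ballot word is copied onto the positive and the negative
labels; in type D some outer labels are left over and form a zero-block with the whole inner circle.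
-/

namespace NCWord

open Finset

/-! ### Non-crossing colourings and their words of block sizes -/

section Words

variable {m : ℕ} {β : Type*} {γ : Type*} [DecidableEq β] [DecidableEq γ]

/-- A colouring of `0, …, m - 1` whose colour classes form a non-crossing partition. -/
def IsNC (κ : Fin m → β) : Prop :=
  ∀ a b c d, a < b → b < c → c < d → κ a = κ c → κ b = κ d → κ a = κ b

/-- The first position with the same colour as `x`. -/
def first (κ : Fin m → β) (x : Fin m) : Fin m :=
  (univ.filter fun i => κ i = κ x).min' ⟨x, by simp⟩

/-- The size of the colour class of `j` if `j` is its first position, and `0` otherwise. -/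
def word (κ : Fin m → β) (j : Fin m) : ℕ := (univ.filter fun i => first κ i = j).card

lemma first_le (κ : Fin m → β) (x : Fin m) : first κ x ≤ x := min'_le _ _ (by simp)

lemma first_le_of_eq (κ : Fin m → β) {x y : Fin m} (h : κ y = κ x) : first κ x ≤ y :=
  min'_le _ _ (by simp [h])

lemma apply_first (κ : Fin m → β) (x : Fin m) : κ (first κ x) = κ x := by
  exact (mem_filter.1 (min'_mem (univ.filter fun i => κ i = κ x) ⟨x, by simp⟩)).2

lemma first_eq_iff (κ : Fin m → β) {x y : Fin m} : first κ x = first κ y ↔ κ x = κ y := by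
  constructor
  · intro h
    rw [← apply_first κ x, h, apply_first κ y]
  · intro h
    simp only [first, h]

lemma first_first (κ : Fin m → β) (x : Fin m) : first κ (first κ x) = first κ x :=
  (first_eq_iff κ).2 (apply_first κ x)

lemma word_eq_of_first (κ : Fin m → β) {j : Fin m} (h : first κ j = j) :
    word κ j = (univ.filter fun i => κ i = κ j).card := by
  unfold word
  congr 1
  ext i
  simp only [mem_filter, mem_univ, true_and]
  rw [← first_eq_iff κ, h]

lemma word_pos_iff (κ : Fin m → β) {j : Fin m} : 0 < word κ j ↔ first κ j = j := by
  constructor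
  · intro h
    obtain ⟨i, hi⟩ := card_pos.1 h
    simp only [mem_filter, mem_univ, true_and] at hi
    rw [← hi, first_first]
  · intro h
    exact card_pos.2 ⟨j, by simp [h]⟩

lemma sum_word (κ : Fin m → β) : ∑ j, word κ j = m := by
  have := card_eq_sum_card_fiberwise (f := first κ) (s := univ) (t := univ) (by simp)
  simpa [word] using this.symm

/-- Otherwise the points first z < first y < z < y would form a crossing. -/
lemma first_le_first {κ : Fin m → β} (hκ : IsNC κ) {y z : Fin m} (h1 : first κ y ≤ z)
    (h2 : z ≤ y) : first κ y ≤ first κ z := by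
  by_contra! h
  rcases h2.eq_or_lt with rfl | h2
  · exact lt_irrefl _ h
  rcases h1.eq_or_lt with h1 | h1
  · rw [← h1, first_first] at h
    exact lt_irrefl _ h
  have := hκ _ _ _ _ h h1 h2 (apply_first κ z) (apply_first κ y)
  rw [apply_first κ z, apply_first κ y, ← first_eq_iff κ] at this
  exact h.ne this

/-- Double counting on the interval [j, x], where j is the later of the two first positions. In κ'
every point of [j, x] has its first position there, so the entries of the word sum to at least x - j
+ 1. In κ a point z ≥ x cannot have its first position in [j, x], since x lies under that arc and
would itself start at or after j; so the same entries sum to at most x - j. -/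
lemma not_first_lt_first {κ : Fin m → β} {κ' : Fin m → γ} (hκ : IsNC κ) (hκ' : IsNC κ')
    (h : word κ = word κ') (x : Fin m) : ¬ first κ x < first κ' x := by
  intro hx
  set j := first κ' x with hj
  have hjx : j ≤ x := first_le κ' x
  have h1 : (Icc j x).card ≤ ∑ i ∈ Icc j x, word κ' i := by
    rw [card_eq_sum_card_fiberwise (f := first κ') (s := Icc j x) (t := Icc j x)]
    · exact sum_le_sum fun i _ => card_le_card (filter_subset_filter _ (subset_univ _))
    · intro z hz
      simp only [coe_Icc, Set.mem_Icc] at hz ⊢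
      exact ⟨first_le_first hκ' hz.1 hz.2, (first_le κ' z).trans hz.2⟩
  have h2 : ∑ i ∈ Icc j x, word κ i ≤ (Ico j x).card := by
    have : ∀ z, first κ z ∈ Icc j x → z ∈ Ico j x := by
      intro z hz
      rw [mem_Icc] at hz
      rw [mem_Ico]
      refine ⟨hz.1.trans (first_le κ z), ?_⟩
      by_contra! hxz
      exact absurd (hz.1.trans (first_le_first hκ hz.2 hxz)) (not_le.2 hx)
    calc ∑ i ∈ Icc j x, word κ i
        = ∑ i ∈ Icc j x, ((Ico j x).filter fun z => first κ z = i).card := by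
          refine sum_congr rfl fun i hi => ?_
          unfold word
          congr 1
          ext z
          simp only [mem_filter, mem_univ, true_and]
          exact ⟨fun hz => ⟨this z (hz ▸ hi), hz⟩, fun hz => hz.2⟩
      _ ≤ (Ico j x).card := by
          rw [← card_biUnion]
          · exact card_le_card (biUnion_subset.2 fun i _ => filter_subset _ _)
          · intro a _ b _ hab
            exact disjoint_filter.2 fun z _ h1 h2 => hab (h1.symm.trans h2)
  rw [h] at h2
  have h3 := h1.trans h2
  rw [Fin.card_Icc, Fin.card_Ico] at h3
  have : (j : ℕ) ≤ x := hjx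
  omega

/-- A non-crossing colouring is determined by its word, up to renaming the colours. -/
theorem ker_eq_of_word_eq {κ : Fin m → β} {κ' : Fin m → γ} (hκ : IsNC κ) (hκ' : IsNC κ')
    (h : word κ = word κ') (x y : Fin m) : κ x = κ y ↔ κ' x = κ' y := by
  have key : ∀ x, first κ x = first κ' x := fun x =>
    le_antisymm (not_lt.1 (not_first_lt_first hκ' hκ h.symm x))
      (not_lt.1 (not_first_lt_first hκ hκ' h x))
  rw [← first_eq_iff κ, ← first_eq_iff κ', key, key]

end Words

/-! ### Non-crossing partitions from ballot words -/

section Ballot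

/-- The height of the walk with steps `F i - 1`. -/
def height (F : ℕ → ℕ) (j : ℕ) : ℤ := ∑ i ∈ range j, ((F i : ℤ) - 1)

/-- The place at which the element that is removed at time `x` was put on the stack. -/
def opener (F : ℕ → ℕ) (x : ℕ) : ℕ := Nat.findGreatest (fun j => height F j ≤ height F (x + 1)) x

/-- The partial sums of `F` are at least the number of summands, with equality for `m`. -/
structure IsBallot (F : ℕ → ℕ) (m : ℕ) : Prop where
  nonneg : ∀ j ≤ m, 0 ≤ height F j
  total : height F m = 0

variable {F : ℕ → ℕ} {m : ℕ}

lemma height_succ (F : ℕ → ℕ) (j : ℕ) : height F (j + 1) = height F j + F j - 1 := by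
  rw [height, sum_range_succ, height]
  ring

lemma opener_le (F : ℕ → ℕ) (x : ℕ) : opener F x ≤ x := Nat.findGreatest_le _

lemma height_opener (hF : IsBallot F m) {x : ℕ} (hx : x < m) :
    height F (opener F x) ≤ height F (x + 1) :=
  Nat.findGreatest_spec (P := fun j => height F j ≤ height F (x + 1)) (Nat.zero_le x)
    (by simpa [height] using hF.nonneg (x + 1) hx)

lemma lt_height_of_opener_lt {x j : ℕ} (h : opener F x < j) (hj : j ≤ x) :
    height F (x + 1) < height F j :=
  not_le.1 (Nat.findGreatest_is_greatest h hj)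

lemma opener_eq (hF : IsBallot F m) {x j : ℕ} (hx : x < m) (hj : j ≤ x)
    (h1 : height F j ≤ height F (x + 1))
    (h2 : ∀ i, j < i → i ≤ x → height F (x + 1) < height F i) : opener F x = j := by
  have h3 : j ≤ opener F x := Nat.le_findGreatest hj h1
  rcases h3.eq_or_lt with h | h
  · exact h.symm
  · exact absurd (height_opener hF hx) (not_le.2 (h2 _ h (opener_le F x)))

/-- If the opener of a came before that of b, the height after c would lie below the height at the
opener of b, hence below or at the height after d; but d still belongs to that earlier opener, so
the height after d is below the height after c. The other order is symmetric. -/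
lemma opener_nc (hF : IsBallot F m) {a b c d : ℕ} (hab : a < b) (hbc : b < c) (hcd : c < d)
    (hd : d < m) (hac : opener F a = opener F c) (hbd : opener F b = opener F d) :
    opener F a = opener F b := by
  have ha := opener_le F a
  have hb := opener_le F b
  rcases lt_trichotomy (opener F a) (opener F b) with h | h | h
  · have h1 := lt_height_of_opener_lt (F := F) (x := c) (j := opener F b) (by omega) (by omega)
    have h2 := height_opener hF hd
    have h3 := lt_height_of_opener_lt (F := F) (x := d) (j := c + 1) (by omega) (by omega)
    rw [← hbd] at h2
    omega
  · exact h
  · have h1 := lt_height_of_opener_lt (F := F) (x := b) (j := opener F a) (by omega) (by omega)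
    have h2 := height_opener hF (hcd.trans hd)
    have h3 := lt_height_of_opener_lt (F := F) (x := c) (j := b + 1) (by omega) (by omega)
    rw [← hac] at h2
    omega

/-- The elements put on the stack at j correspond to the levels from `height F j` up to `height F j
+ F j - 1`. The walk descends by at most 1 per step and ends at 0, so it reaches every such level;
the first time it does so from j on is the removal of that element. -/
lemma card_opener (hF : IsBallot F m) {j : ℕ} (hj : j < m) :
    ((range m).filter fun x => opener F x = j).card = F j := by
  have h : ((range m).filter fun x => opener F x = j).card
      = (Finset.Ico (height F j) (height F j + F j)).card := by
    refine card_bij (fun x _ => height F (x + 1)) ?_ ?_ ?_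
    · intro x hx
      simp only [mem_filter, mem_range] at hx
      rw [mem_Ico]
      have h1 := height_opener hF hx.1
      rw [hx.2] at h1
      refine ⟨h1, ?_⟩
      have h2 := opener_le F x
      have h3 := height_succ F j
      rcases h2.eq_or_lt with h2 | h2
      · rw [← hx.2, h2] at h3 ⊢
        omega
      · have h4 := lt_height_of_opener_lt (F := F) (x := x) (j := j + 1) (by omega) (by omega)
        omega
    · have key : ∀ x y, x < y → opener F x = j → opener F y = j →
          height F (x + 1) ≠ height F (y + 1) := by
        intro x y hxy hx hy
        have h1 := opener_le F x
        exact (lt_height_of_opener_lt (F := F) (x := y) (j := x + 1) (by omega) (by omega)).ne'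
      intro x hx y hy hxy
      simp only [mem_filter, mem_range] at hx hy
      rcases lt_trichotomy x y with h | h | h
      · exact absurd hxy (key x y h hx.2 hy.2)
      · exact h
      · exact absurd hxy.symm (key y x h hy.2 hx.2)
    · intro l hl
      rw [mem_Ico] at hl
      have hex : ∃ i, j ≤ i ∧ i < m ∧ height F (i + 1) ≤ l := by
        refine ⟨m - 1, by omega, by omega, ?_⟩
        rw [Nat.sub_add_cancel (by omega), hF.total]
        exact (hF.nonneg j hj.le).trans hl.1
      classical
      obtain ⟨h1, h2, h3⟩ := Nat.find_spec hex
      have hmin : ∀ i, j ≤ i → i < Nat.find hex → l < height F (i + 1) := by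
        intro i hi hlt
        by_contra! h
        exact Nat.find_min hex hlt ⟨hi, by omega, h⟩
      set i := Nat.find hex with hi
      have heq : height F (i + 1) = l := by
        rw [height_succ] at h3 ⊢
        rcases h1.eq_or_lt with h | h
        · rw [← h] at h3 ⊢
          omega
        · have := hmin (i - 1) (by omega) (by omega)
          rw [Nat.sub_add_cancel (by omega)] at this
          omega
      refine ⟨i, ?_, heq⟩
      simp only [mem_filter, mem_range]
      refine ⟨h2, opener_eq hF h2 h1 (by omega) fun i' h4 h5 => ?_⟩
      have := hmin (i' - 1) (by omega) (by omega)
      rw [Nat.sub_add_cancel (by omega)] at this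
      omega
  rw [h]
  simp

lemma opener_opener (hF : IsBallot F m) {x : ℕ} (hx : x < m) :
    opener F (opener F x) = opener F x := by
  have hle := opener_le F x
  refine opener_eq hF (by omega) le_rfl ?_ (by omega)
  have h1 : 0 < F (opener F x) := by
    rw [← card_opener hF (j := opener F x) (by omega)]
    exact card_pos.2 ⟨x, by simp [hx]⟩
  rw [height_succ]
  omega

/-- The colouring of `0, …, m - 1` by the openers. -/
def openerColouring (F : ℕ → ℕ) (m : ℕ) (x : Fin m) : ℕ := opener F x

lemma first_openerColouring (hF : IsBallot F m) (x : Fin m) :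
    (first (openerColouring F m) x : ℕ) = opener F x := by
  have h1 : opener F x < m := (opener_le F x).trans_lt x.2
  have h2 := first_le_of_eq (openerColouring F m) (x := x) (y := ⟨opener F x, h1⟩)
    (opener_opener hF x.2)
  have h3 : opener F (first (openerColouring F m) x) = opener F x :=
    apply_first (openerColouring F m) x
  have h4 := opener_le F (first (openerColouring F m) x)
  have h5 : (first (openerColouring F m) x : ℕ) ≤ opener F x := h2
  omega

lemma word_openerColouring (hF : IsBallot F m) (j : Fin m) :
    word (openerColouring F m) j = F j := by
  rw [← card_opener hF j.2, word]
  refine card_bij (fun x _ => (x : ℕ)) ?_ (fun x _ y _ h => Fin.ext h) ?_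
  · intro x hx
    simp only [mem_filter, mem_univ, true_and, mem_range] at hx ⊢
    refine ⟨x.2, ?_⟩
    rw [← first_openerColouring hF, hx]
  · intro x hx
    simp only [mem_filter, mem_range] at hx
    refine ⟨⟨x, hx.1⟩, ?_, rfl⟩
    simp only [mem_filter, mem_univ, true_and]
    exact Fin.ext ((first_openerColouring hF _).trans hx.2)

end Ballot

/-! ### Lower bound for the number of ballot words -/

section Counting

/-- The binomial distribution with parameters `(k + 1) n` and `1 / (k + 1)` has its mode at `n`. -/
lemma choose_mul_pow_le (k n i : ℕ) (hi : i ≤ (k + 1) * n) :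
    ((k + 1) * n).choose i * k ^ ((k + 1) * n - i) ≤
      ((k + 1) * n).choose n * k ^ ((k + 1) * n - n) := by
  set L := (k + 1) * n with hL
  have hnL : n ≤ L := by rw [hL]; exact Nat.le_mul_of_pos_left _ (Nat.succ_pos k)
  -- The ratio of consecutive terms is (L - j) / (k (j + 1)), which is at least 1 for j < n and at
  -- most 1 for j ≥ n.
  have step : ∀ j, j < L → L.choose (j + 1) * k ^ (L - (j + 1)) * (k * (j + 1)) =
      L.choose j * k ^ (L - j) * (L - j) := by
    intro j hj
    have h1 := Nat.choose_succ_right_eq L j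
    have h2 : L - j = L - (j + 1) + 1 := by omega
    calc L.choose (j + 1) * k ^ (L - (j + 1)) * (k * (j + 1))
        = (L.choose (j + 1) * (j + 1)) * (k ^ (L - (j + 1)) * k) := by ring
      _ = (L.choose j * (L - j)) * k ^ (L - j) := by rw [h1, ← pow_succ, ← h2]
      _ = _ := by ring
  rcases le_total i n with h | h
  · refine Nat.le_induction (m := i)
      (P := fun j _ => j ≤ n → L.choose i * k ^ (L - i) ≤ L.choose j * k ^ (L - j))
      (fun _ => le_rfl) ?_ n h le_rfl
    intro j _ ih hjn
    refine (ih (by omega)).trans ?_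
    have h1 := step j (by omega)
    have h2 : k * (j + 1) ≤ L - j := by
      have h3 : (k + 1) * (j + 1) ≤ L := Nat.mul_le_mul_left _ hjn
      have h4 : (k + 1) * (j + 1) = k * (j + 1) + (j + 1) := by ring
      omega
    refine Nat.le_of_mul_le_mul_right (c := L - j) ?_ (by omega)
    rw [← h1]
    exact Nat.mul_le_mul_left _ h2
  · refine Nat.le_induction (m := n)
      (P := fun j _ => j ≤ L → L.choose j * k ^ (L - j) ≤ L.choose n * k ^ (L - n))
      (fun _ => le_rfl) ?_ i h hi
    intro j hj ih hjL
    refine le_trans ?_ (ih (by omega))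
    have h1 := step j (by omega)
    have h2 : L - j ≤ k * (j + 1) := by
      have h3 : k * n ≤ k * (j + 1) := Nat.mul_le_mul_left _ (by omega)
      have h4 : L = k * n + n := by rw [hL]; ring
      omega
    refine Nat.le_of_mul_le_mul_right (c := L - j) ?_ (by omega)
    rw [← h1]
    exact Nat.mul_le_mul_left _ h2

lemma pow_le_choose (k n : ℕ) :
    (k + 1) ^ ((k + 1) * n) ≤ ((k + 1) * n + 1) * (((k + 1) * n).choose n * k ^ (k * n)) := by
  have h := add_pow 1 k ((k + 1) * n)
  rw [add_comm 1 k] at h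
  rw [h]
  refine (sum_le_card_nsmul _ _ (((k + 1) * n).choose n * k ^ (k * n)) ?_).trans (by simp)
  intro i hi
  rw [mem_range] at hi
  have h1 := choose_mul_pow_le k n i (by omega)
  have h2 : (k + 1) * n - n = k * n := by rw [add_mul, one_mul, Nat.add_sub_cancel]
  rw [h2] at h1
  rw [one_pow, one_mul, mul_comm]
  simpa using h1

/-- Multiply a word by `k` and extend it by zero. -/
def scale (k : ℕ) {N : ℕ} (f : Fin N → ℕ) (i : ℕ) : ℕ := if h : i < N then k * f ⟨i, h⟩ else 0

open Classical in
/-- The words of length `N` with sum `n` that become ballot words when multiplied by `k`. -/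
noncomputable def ballotWords (k N n : ℕ) : Finset (Fin N → ℕ) :=
  (piAntidiag univ n).filter fun f => IsBallot (scale k f) N

lemma height_add (F : ℕ → ℕ) (a j : ℕ) :
    height F (a + j) = height F a + height (fun i => F (a + i)) j := by
  simp only [height, sum_range_add]

lemma height_congr {F G : ℕ → ℕ} {j : ℕ} (h : ∀ i < j, F i = G i) : height F j = height G j :=
  sum_congr rfl fun i hi => by rw [h i (mem_range.1 hi)]

lemma height_scale (k : ℕ) {N : ℕ} (f : Fin N → ℕ) :
    height (scale k f) N = k * ∑ i, (f i : ℤ) - N := by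
  rw [height, sum_range, sum_sub_distrib, mul_sum]
  simp [scale]

/-- The word `g` read cyclically from position `a`. -/
def rotate {N : ℕ} (hN : 0 < N) (g : Fin N → ℕ) (a : ℕ) (i : Fin N) : ℕ :=
  g ⟨(a + i) % N, Nat.mod_lt _ hN⟩

lemma rotate_injective {N : ℕ} (hN : 0 < N) (a : ℕ) :
    Function.Injective fun g : Fin N → ℕ => rotate hN g a := by
  intro g g' h
  ext i
  have h1 := congrFun h ⟨(i + (N - a % N)) % N, Nat.mod_lt _ hN⟩
  have h2 : (a + (i + (N - a % N)) % N) % N = i := by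
    have h3 := Nat.mod_lt a hN
    rw [Nat.add_mod_mod, ← Nat.mod_add_mod, ← Nat.add_sub_assoc h3.le,
      Nat.add_sub_cancel' (by omega), Nat.add_mod_right, Nat.mod_eq_of_lt i.2]
  simpa only [rotate, h2] using h1

/-- Every word has a rotation that is a ballot word. -/
lemma exists_rotate_isBallot {k N n : ℕ} (hN : 0 < N) (hkn : N = k * n) (g : Fin N → ℕ)
    (hg : ∑ i, g i = n) : ∃ a : Fin N, IsBallot (scale k (rotate hN g a)) N := by
  set G : ℕ → ℕ := fun i => k * g ⟨i % N, Nat.mod_lt _ hN⟩ with hG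
  have hGN : height G N = 0 := by
    have : height G N = height (scale k g) N := by
      refine height_congr fun i hi => ?_
      simp [hG, scale, hi, Nat.mod_eq_of_lt hi]
    rw [this, height_scale, ← Nat.cast_sum, hg, hkn]
    push_cast
    ring
  have hper : ∀ j, height G (N + j) = height G j := by
    intro j
    rw [height_add, hGN, zero_add]
    refine height_congr fun i _ => ?_
    simp [hG]
  -- Cycle lemma: read from a minimum of the periodic walk, the word never goes below its starting
  -- height.
  obtain ⟨a, -, ha⟩ := exists_min_image (univ : Finset (Fin N)) (fun i => height G i)
    ⟨⟨0, hN⟩, mem_univ _⟩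
  have hmin : ∀ j, height G a ≤ height G j := by
    intro j
    induction j using Nat.strong_induction_on with
    | _ j ih =>
      rcases lt_or_ge j N with h | h
      · exact ha ⟨j, h⟩ (mem_univ _)
      · rw [← Nat.add_sub_cancel' h, hper]
        exact ih _ (by omega)
  have hrot : ∀ j ≤ N, height (scale k (rotate hN g a)) j = height G (a + j) - height G a := by
    intro j hj
    rw [height_add, add_sub_cancel_left]
    refine height_congr fun i hi => ?_
    simp [scale, rotate, hG, show i < N by omega]
  refine ⟨a, fun j hj => ?_, ?_⟩
  · rw [hrot j hj]
    have := hmin (a + j)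
    omega
  · rw [hrot N le_rfl, add_comm, hper, sub_self]

/-- A word is recovered from its ballot rotation and the starting point, so each ballot word arises
at most N times. -/
lemma card_piAntidiag_le {k N n : ℕ} (hk : 0 < k) (hN : 0 < N) (hkn : N = k * n) :
    (piAntidiag (univ : Finset (Fin N)) n).card ≤ N * (ballotWords k N n).card := by
  classical
  have h : ∀ g : Fin N → ℕ, ∃ a : Fin N,
      ∑ i, g i = n → IsBallot (scale k (rotate hN g a)) N := by
    intro g
    by_cases hg : ∑ i, g i = n
    · obtain ⟨a, ha⟩ := exists_rotate_isBallot hN hkn g hg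
      exact ⟨a, fun _ => ha⟩
    · exact ⟨⟨0, hN⟩, fun h => absurd h hg⟩
  choose a ha using h
  have : N * (ballotWords k N n).card
      = ((univ : Finset (Fin N)) ×ˢ ballotWords k N n).card := by
    rw [card_product, card_univ, Fintype.card_fin]
  rw [this]
  refine card_le_card_of_injOn (fun g => (a g, rotate hN g (a g))) ?_ ?_
  · intro g hg
    simp only [mem_coe, mem_piAntidiag, mem_univ, implies_true, and_true] at hg
    have h1 := ha g hg
    simp only [coe_product, Set.mem_prod, mem_coe, mem_univ, true_and, ballotWords, mem_filter,
      mem_piAntidiag, implies_true, and_true]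
    refine ⟨?_, h1⟩
    have h2 := h1.total
    rw [height_scale, ← Nat.cast_sum, sub_eq_zero] at h2
    exact Nat.eq_of_mul_eq_mul_left hk ((by exact_mod_cast h2 : _ = N).trans hkn)
  · intro g _ g' _ h
    simp only [Prod.mk.injEq] at h
    rw [← h.1] at h
    exact rotate_injective hN _ h.2

/-- The exponential growth rate of the numbers of `k`-divisible non-crossing partitions. -/
noncomputable def growth (k : ℕ) : ℝ := ((k : ℝ) + 1) ^ (k + 1) / (k : ℝ) ^ k

lemma growth_pos {k : ℕ} (hk : 0 < k) : 0 < growth k := by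
  unfold growth
  positivity

/-- The largest term of (1 + k)^((k+1)n) is at least the average term; its binomial coefficient is,
up to a factor 2, the stars-and-bars number of words of length kn and sum n, of which a fraction at
least 1/(kn) are ballot words. -/
theorem growth_pow_le (k n : ℕ) (hk : 0 < k) (hn : 0 < n) :
    growth k ^ n ≤ ((2 * k : ℕ) * (n + 1 : ℝ)) ^ 2 * (ballotWords k (k * n) n).card := by
  have hN : 0 < k * n := Nat.mul_pos hk hn
  have h1 := pow_le_choose k n
  have h2 := card_piAntidiag_le hk hN rfl
  have h3 : (k * n + n - 1).choose n ≤ (piAntidiag (univ : Finset (Fin (k * n))) n).card := by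
    have := card_finsuppAntidiag_nat_eq_choose (s := (univ : Finset (Fin (k * n)))) n
    rw [card_univ, Fintype.card_fin] at this
    rw [← this]
    refine card_le_card_of_injOn (fun f => ⇑f) ?_ DFunLike.coe_injective.injOn
    intro f hf
    simp only [mem_coe, mem_finsuppAntidiag] at hf
    simpa using hf.1
  -- The two binomial coefficients have ratio (k + 1)/k, which is at most 2.
  have h4 : ((k + 1) * n).choose n ≤ 2 * (k * n + n - 1).choose n := by
    have h5 := Nat.choose_mul_succ_eq (k * n + n - 1) n
    have h6 : k * n + n - 1 + 1 = (k + 1) * n := by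
      rw [Nat.sub_add_cancel (by omega)]
      ring
    rw [h6, show (k + 1) * n - n = k * n by rw [add_mul, one_mul, Nat.add_sub_cancel]] at h5
    refine Nat.le_of_mul_le_mul_right (c := k * n) ?_ hN
    rw [← h5]
    have h7 : (k + 1) * n ≤ 2 * (k * n) := by nlinarith
    calc _ ≤ (k * n + n - 1).choose n * (2 * (k * n)) := Nat.mul_le_mul_left _ h7
      _ = _ := by ring
  have h5 : (k + 1) ^ ((k + 1) * n) ≤
      (2 * k * (n + 1)) ^ 2 * (ballotWords k (k * n) n).card * k ^ (k * n) := by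
    refine h1.trans ?_
    rw [← mul_assoc]
    refine Nat.mul_le_mul_right _ ?_
    calc ((k + 1) * n + 1) * ((k + 1) * n).choose n
        ≤ ((k + 1) * n + 1) * (2 * (k * n * (ballotWords k (k * n) n).card)) :=
          Nat.mul_le_mul_left _ (h4.trans (Nat.mul_le_mul_left _ (h3.trans h2)))
      _ = (((k + 1) * n + 1) * (2 * (k * n))) * (ballotWords k (k * n) n).card := by ring
      _ ≤ _ := by
          refine Nat.mul_le_mul_right _ ?_
          rw [sq]
          refine Nat.mul_le_mul ?_ ?_ <;> nlinarith
  have h6 : ((k : ℝ) + 1) ^ ((k + 1) * n) ≤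
      ((2 * k : ℕ) * (n + 1 : ℝ)) ^ 2 * (ballotWords k (k * n) n).card * (k : ℝ) ^ (k * n) := by
    exact_mod_cast h5
  rw [growth, div_pow, ← pow_mul, ← pow_mul, div_le_iff₀ (by positivity)]
  exact h6

end Counting

/-! ### Large deviations by exponential tilting -/

section Chernoff

/-- The words of length and sum `m` with at most `e` entries that are not multiples of `k`. -/
def almostDivisible (k m e : ℕ) : Finset (Fin m → ℕ) :=
  (piAntidiag univ m).filter fun w => (univ.filter fun j => ¬ k ∣ w j).card ≤ e

/-- The number of entries equal to `s`. -/
def count {m : ℕ} (w : Fin m → ℕ) (s : ℕ) : ℕ := (univ.filter fun j => w j = s).card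

/-- The limiting proportion of entries equal to `t * k`. -/
noncomputable def density (k t : ℕ) : ℝ := (k : ℝ) / (k + 1) * (1 / ((k : ℝ) + 1)) ^ t

/-- An exponentially tilted geometric weight on the multiples of `k`, smeared out over the other
numbers with weight `y`. -/
noncomputable def weight (k t : ℕ) (y l : ℝ) (v : ℕ) : ℝ :=
  (if k ∣ v then (k : ℝ) / (k + 1) else y) * (1 / ((k : ℝ) + 1)) ^ (v / k) *
    Real.exp (if v = t * k then l else 0)

lemma sum_weight_block (k t : ℕ) (hk : 0 < k) (y l : ℝ) (L : ℕ) :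
    ∑ r ∈ range k, weight k t y l (k * L + r) =
      (1 / ((k : ℝ) + 1)) ^ L * ((k : ℝ) / (k + 1) * Real.exp (if L = t then l else 0) +
        (k - 1) * y) := by
  obtain ⟨k', rfl⟩ : ∃ k', k = k' + 1 := ⟨k - 1, by omega⟩
  have h : ∀ r ∈ range k', weight (k' + 1) t y l ((k' + 1) * L + (r + 1)) =
      y * (1 / (((k' + 1 : ℕ) : ℝ) + 1)) ^ L := by
    intro r hr
    rw [mem_range] at hr
    have h1 : ¬ (k' + 1) ∣ (k' + 1) * L + (r + 1) := by
      rw [Nat.dvd_add_right (Dvd.intro _ rfl)]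
      exact Nat.not_dvd_of_pos_of_lt (Nat.succ_pos r) (by omega)
    have h2 : (k' + 1) * L + (r + 1) ≠ t * (k' + 1) := fun h => h1 (h ▸ Dvd.intro_left _ rfl)
    have h3 : ((k' + 1) * L + (r + 1)) / (k' + 1) = L := by
      rw [Nat.mul_add_div (Nat.succ_pos k'), Nat.div_eq_of_lt (by omega), add_zero]
    rw [weight, if_neg h1, if_neg h2, h3, Real.exp_zero, mul_one]
  rw [sum_range_succ', sum_congr rfl h, sum_const, card_range, nsmul_eq_mul, weight, add_zero,
    if_pos (Dvd.intro _ rfl), Nat.mul_div_cancel_left _ (Nat.succ_pos k')]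
  have h4 : (k' + 1) * L = t * (k' + 1) ↔ L = t := by
    rw [mul_comm, Nat.mul_left_inj (Nat.succ_ne_zero k')]
  simp only [h4]
  push_cast
  ring

/-- Without tilt and smearing the weight is a geometric probability distribution on the multiples of
k. The tilt only changes the mass `density k t` of t * k, and the smearing adds at most (k - 1/k) y.
-/
lemma sum_weight_le (k t : ℕ) (hk : 0 < k) {y : ℝ} (hy : 0 ≤ y) (l : ℝ) {L : ℕ} (hL : t < L) :
    ∑ v ∈ range (k * L), weight k t y l v ≤ 1 + (density k t * (Real.exp l - 1) + k * y) := by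
  have hk' : (1 : ℝ) ≤ k := by exact_mod_cast hk
  have h1 : ∀ L : ℕ, ∑ v ∈ range (k * L), weight k t y l v =
      ∑ i ∈ range L, (1 / ((k : ℝ) + 1)) ^ i *
        ((k : ℝ) / (k + 1) * Real.exp (if i = t then l else 0) + (k - 1) * y) := by
    intro L
    induction L with
    | zero => simp
    | succ L ih => rw [Nat.mul_succ, sum_range_add, ih, sum_range_succ, sum_weight_block k t hk]
  have h2 : ∀ i ∈ range L, (1 / ((k : ℝ) + 1)) ^ i *
      ((k : ℝ) / (k + 1) * Real.exp (if i = t then l else 0) + (k - 1) * y) =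
      (1 / ((k : ℝ) + 1)) ^ i * ((k : ℝ) / (k + 1) + (k - 1) * y) +
        if i = t then density k t * (Real.exp l - 1) else 0 := by
    intro i _
    split_ifs with h
    · rw [h, density]
      ring
    · rw [Real.exp_zero]
      ring
  rw [h1, sum_congr rfl h2, sum_add_distrib, sum_ite_eq' _ _ _, if_pos (mem_range.2 hL),
    ← sum_mul]
  have h3 : ∑ i ∈ range L, (1 / ((k : ℝ) + 1)) ^ i ≤ (k + 1) / k := by
    have h4 : (1 / ((k : ℝ) + 1)) < 1 := by
      rw [div_lt_one (by positivity)]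
      linarith
    rw [geom_sum_eq h4.ne, ← neg_div_neg_eq, neg_sub, neg_sub, div_le_div_iff₀ (by linarith)
      (by positivity)]
    have h5 : (0 : ℝ) ≤ (1 / ((k : ℝ) + 1)) ^ L := by positivity
    have h6 : ((k : ℝ) + 1) * (1 - 1 / (k + 1)) = k := by
      field_simp
      ring
    rw [h6]
    nlinarith
  have h4 : (0 : ℝ) ≤ (k : ℝ) / (k + 1) + (k - 1) * y :=
    add_nonneg (by positivity) (mul_nonneg (by linarith) hy)
  have h5 := mul_le_mul_of_nonneg_right h3 h4
  have h6 : ((k : ℝ) + 1) / k * ((k : ℝ) / (k + 1) + (k - 1) * y) =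
      1 + (k - 1 / k) * y := by
    field_simp
    ring
  have h7 : (k - 1 / (k : ℝ)) * y ≤ k * y := by
    refine mul_le_mul_of_nonneg_right ?_ hy
    have : (0 : ℝ) ≤ 1 / k := by positivity
    linarith
  linarith

/-- If all entries are multiples of k, the untilted weight depends only on length and sum, and
equals 1 / `growth k` ^ n. Each of the at most e other entries costs at most a factor y, and
rounding its quotient down only increases the geometric factor. -/
lemma prod_weight_ge {k m n e t : ℕ} (hk : 0 < k) (hm : m = k * n) {y : ℝ} (hy : 0 < y) (hy1 : y ≤ 1) (l : ℝ)
    {w : Fin m → ℕ} (hw : w ∈ almostDivisible k m e) :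
    (growth k ^ n)⁻¹ * y ^ e * Real.exp (l * count w (t * k)) ≤ ∏ j, weight k t y l (w j) := by
  simp only [almostDivisible, mem_filter, mem_piAntidiag, mem_univ, implies_true, and_true] at hw
  have hq : (0 : ℝ) < 1 / ((k : ℝ) + 1) := by positivity
  have hq1 : 1 / ((k : ℝ) + 1) ≤ 1 := by
    rw [div_le_one (by positivity)]
    linarith [(Nat.cast_nonneg k : (0 : ℝ) ≤ k)]
  have hp1 : (k : ℝ) / (k + 1) ≤ 1 := by
    rw [div_le_one (by positivity)]
    linarith
  have hp : (0 : ℝ) < (k : ℝ) / (k + 1) := by positivity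
  have h1 : ((k : ℝ) / (k + 1)) ^ m * y ^ e ≤
      ∏ j, if k ∣ w j then (k : ℝ) / (k + 1) else y := by
    rw [prod_ite, prod_const, prod_const]
    refine mul_le_mul (pow_le_pow_of_le_one hp.le hp1 ?_) (pow_le_pow_of_le_one hy.le hy1 hw.2)
      (by positivity) (by positivity)
    exact (card_le_univ _).trans (by simp)
  have h2 : (1 / ((k : ℝ) + 1)) ^ n ≤ ∏ j, (1 / ((k : ℝ) + 1)) ^ (w j / k) := by
    rw [prod_pow_eq_pow_sum]
    refine pow_le_pow_of_le_one hq.le hq1 ?_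
    refine Nat.le_of_mul_le_mul_left (c := k) ?_ hk
    rw [← hm]
    refine le_trans ?_ hw.1.le
    rw [mul_sum]
    exact sum_le_sum fun j _ => Nat.mul_div_le _ _
  have h3 : ∏ j, Real.exp (if w j = t * k then l else 0) = Real.exp (l * count w (t * k)) := by
    rw [← Real.exp_sum, ← sum_filter, sum_const, nsmul_eq_mul, mul_comm, count]
  have h4 : (growth k ^ n)⁻¹ = ((k : ℝ) / (k + 1)) ^ m * (1 / ((k : ℝ) + 1)) ^ n := by
    rw [growth, ← inv_pow, inv_div, hm, pow_mul, ← mul_pow, div_pow _ _ k, div_mul_div_comm,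
      mul_one, ← pow_succ]
  simp only [weight, prod_mul_distrib]
  rw [h3, h4]
  refine mul_le_mul_of_nonneg_right ?_ (Real.exp_pos _).le
  calc _ = (((k : ℝ) / (k + 1)) ^ m * y ^ e) * (1 / ((k : ℝ) + 1)) ^ n := by ring
    _ ≤ _ := mul_le_mul h1 h2 (by positivity) (prod_nonneg fun j _ => by split_ifs <;> positivity)

lemma density_nonneg (k t : ℕ) : 0 ≤ density k t := by
  unfold density
  positivity

lemma density_le_one (k t : ℕ) : density k t ≤ 1 := by
  unfold density
  have h0 : (0 : ℝ) ≤ k := Nat.cast_nonneg k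
  refine mul_le_one₀ ?_ (by positivity) (pow_le_one₀ (by positivity) ?_)
  · rw [div_le_one (by positivity)]
    linarith
  · rw [div_le_one (by positivity)]
    linarith

/-- Exponential Chebyshev inequality: every word of S has a large tilted weight, while the total
weight of all words is the m-th power of a one-letter sum. The sign of l selects the upper or the
lower tail. -/
lemma card_tilted_le {k m n : ℕ} (hk : 0 < k) (hm : m = k * n) (e t : ℕ) {ε l : ℝ} (hε : 0 < ε) (hε1 : ε ≤ 1)
    (hl : |l| = ε / 2) {S : Finset (Fin m → ℕ)} (hS : S ⊆ almostDivisible k m e)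
    (hSl : ∀ w ∈ S, |l| * (ε * m) ≤ l * (count w (t * k) - density k t * m)) :
    (S.card : ℝ) ≤
      (8 * k / ε ^ 2) ^ e * growth k ^ n * Real.exp (-(ε ^ 2 / 8) * m) := by
  -- Per letter the deviation gains |l| ε = ε²/2, the second-order term of the tilt costs at most l²
  -- = ε²/4, and the smearing costs k y = ε²/8. This leaves the rate ε²/8.
  set y : ℝ := ε ^ 2 / (8 * k) with hy
  have hk' : (1 : ℝ) ≤ k := by exact_mod_cast hk
  have hy0 : 0 < y := by positivity
  have hy1 : y ≤ 1 := by
    rw [hy, div_le_one (by positivity)]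
    nlinarith
  have hG := growth_pos hk
  have h1 : ∀ w ∈ S, (growth k ^ n)⁻¹ * y ^ e *
      Real.exp (l * density k t * m + |l| * (ε * m)) ≤ ∏ j, weight k t y l (w j) := by
    intro w hw
    refine le_trans ?_ (prod_weight_ge hk hm hy0 hy1 l (hS hw))
    refine mul_le_mul_of_nonneg_left (Real.exp_le_exp.2 ?_) (by positivity)
    have := hSl w hw
    linarith
  have h2 : ∑ w ∈ S, ∏ j, weight k t y l (w j) ≤
      (1 + (density k t * (Real.exp l - 1) + k * y)) ^ m := by
    have hw0 : ∀ v, 0 ≤ weight k t y l v := by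
      intro v
      unfold weight
      split_ifs <;> positivity
    -- The entries are at most m; the range is enlarged by t so that it contains the tilted atom t *
    -- k, as `sum_weight_le` requires.
    calc ∑ w ∈ S, ∏ j, weight k t y l (w j)
        ≤ ∑ w ∈ Fintype.piFinset fun _ : Fin m => range (k * (m + t + 1)),
            ∏ j, weight k t y l (w j) := by
          refine sum_le_sum_of_subset_of_nonneg ?_ fun w _ _ => prod_nonneg fun j _ => hw0 _
          intro w hw
          have hw' := hS hw
          simp only [almostDivisible, mem_filter, mem_piAntidiag] at hw'
          rw [Fintype.mem_piFinset]
          intro j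
          rw [mem_range]
          have : w j ≤ m := by
            rw [← hw'.1.1]
            exact single_le_sum (f := w) (fun _ _ => Nat.zero_le _) (mem_univ j)
          calc w j < m + t + 1 := by omega
            _ ≤ k * (m + t + 1) := Nat.le_mul_of_pos_left _ hk
      _ = (∑ v ∈ range (k * (m + t + 1)), weight k t y l v) ^ m := by
          rw [sum_prod_piFinset, prod_const, card_univ, Fintype.card_fin]
      _ ≤ _ := pow_le_pow_left₀ (sum_nonneg fun v _ => hw0 v)
          (sum_weight_le k t hk hy0.le l (by omega)) m
  have h3 : (1 + (density k t * (Real.exp l - 1) + k * y)) ^ m ≤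
      Real.exp (m * (density k t * (Real.exp l - 1) + k * y)) := by
    rw [Real.exp_nat_mul]
    refine pow_le_pow_left₀ ?_ ?_ m
    · have h4 := density_le_one k t
      have h5 := density_nonneg k t
      have h6 := Real.exp_pos l
      have h7 : 0 ≤ (k : ℝ) * y := by positivity
      nlinarith
    · rw [add_comm]
      exact Real.add_one_le_exp _
  have h4 := (card_nsmul_le_sum S _ _ h1).trans (h2.trans h3)
  rw [nsmul_eq_mul] at h4
  have h5 : m * (density k t * (Real.exp l - 1) + k * y) ≤
      (l * density k t * m + |l| * (ε * m)) + -(ε ^ 2 / 8) * m := by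
    have h6 := Real.abs_exp_sub_one_sub_id_le (x := l) (by rw [hl]; linarith)
    have h7 := (abs_le.1 h6).2
    have h8 : l ^ 2 = ε ^ 2 / 4 := by
      rw [← sq_abs, hl]
      ring
    have h9 : (k : ℝ) * y = ε ^ 2 / 8 := by
      rw [hy]
      field_simp
    have h10 : density k t * (Real.exp l - 1 - l) ≤ ε ^ 2 / 4 := by
      rw [h8] at h7
      have h11 := density_le_one k t
      have h12 := density_nonneg k t
      nlinarith [sq_nonneg ε]
    have h11 : density k t * (Real.exp l - 1) + k * y ≤
        l * density k t + |l| * ε - ε ^ 2 / 8 := by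
      rw [h9, hl]
      nlinarith
    have h12 : (0 : ℝ) ≤ m := Nat.cast_nonneg m
    nlinarith
  have h6 := h4.trans (Real.exp_le_exp.2 h5)
  rw [Real.exp_add] at h6
  have hE := Real.exp_pos (l * density k t * m + |l| * (ε * m))
  have h7 : (S.card : ℝ) * ((growth k ^ n)⁻¹ * y ^ e) ≤ Real.exp (-(ε ^ 2 / 8) * m) := by
    refine le_of_mul_le_mul_right ?_ hE
    rw [mul_assoc, mul_comm (Real.exp _)]
    simpa only [Real.exp_add] using h6
  have h8 : (8 * k / ε ^ 2) ^ e = (y ^ e)⁻¹ := by rw [hy, ← inv_pow, inv_div]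
  rw [h8]
  calc (S.card : ℝ) = (S.card : ℝ) * ((growth k ^ n)⁻¹ * y ^ e) * ((y ^ e)⁻¹ * growth k ^ n) := by
        field_simp
    _ ≤ Real.exp (-(ε ^ 2 / 8) * m) * ((y ^ e)⁻¹ * growth k ^ n) :=
        mul_le_mul_of_nonneg_right h7 (by positivity)
    _ = (y ^ e)⁻¹ * growth k ^ n * Real.exp (-(ε ^ 2 / 8) * m) := by ring

/-- Large deviations of the number of entries equal to `t * k`. -/
theorem card_deviation_le {k m n : ℕ} (hk : 0 < k) (hm : m = k * n) (e t : ℕ) {ε : ℝ} (hε : 0 < ε) (hε1 : ε ≤ 1) :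
    (((almostDivisible k m e).filter fun w => ε * m ≤
      |(count w (t * k) : ℝ) - density k t * m|).card : ℝ) ≤
      2 * (8 * k / ε ^ 2) ^ e * growth k ^ n * Real.exp (-(ε ^ 2 / 8) * m) := by
  classical
  have h2 : |ε / 2| = ε / 2 := abs_of_pos (by linarith)
  have h1 := card_tilted_le hk hm e t hε hε1 (l := ε / 2) h2
    (S := (almostDivisible k m e).filter fun w => ε * m ≤
      (count w (t * k) : ℝ) - density k t * m) (filter_subset _ _) (by
        intro w hw
        rw [h2]
        exact mul_le_mul_of_nonneg_left (mem_filter.1 hw).2 (by linarith))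
  have h3 := card_tilted_le hk hm e t hε hε1 (l := -(ε / 2)) (by rw [abs_neg, h2])
    (S := (almostDivisible k m e).filter fun w => ε * m ≤
      -((count w (t * k) : ℝ) - density k t * m)) (filter_subset _ _) (by
        intro w hw
        rw [abs_neg, h2, neg_mul_comm]
        exact mul_le_mul_of_nonneg_left (mem_filter.1 hw).2 (by linarith))
  have h4 : ((almostDivisible k m e).filter fun w => ε * m ≤
      |(count w (t * k) : ℝ) - density k t * m|).card ≤ _ :=
    (card_le_card (t := ((almostDivisible k m e).filter fun w => ε * m ≤
      (count w (t * k) : ℝ) - density k t * m) ∪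
      ((almostDivisible k m e).filter fun w => ε * m ≤
      -((count w (t * k) : ℝ) - density k t * m))) (by
        rw [← filter_or]
        exact fun w hw => by simpa only [mem_filter, le_abs] using hw)).trans (card_union_le _ _)
  have h5 : ((((almostDivisible k m e).filter fun w => ε * m ≤
      |(count w (t * k) : ℝ) - density k t * m|).card : ℕ) : ℝ) ≤ _ :=
    Nat.cast_le.2 h4
  rw [Nat.cast_add] at h5
  linarith

end Chernoff

/-! ### From concentration to the asymptotics of the expectation -/

section Expectation

lemma tendsto_pow_mul_exp_neg (A : ℝ) (d : ℕ) {δ : ℝ} (hδ : 0 < δ) :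
    Tendsto (fun n : ℕ => A * ((n : ℝ) + 1) ^ d * Real.exp (-δ * n)) atTop (nhds 0) := by
  have hr : |Real.exp (-δ)| < 1 := by
    rw [abs_of_pos (Real.exp_pos _), Real.exp_lt_one_iff]
    linarith
  have h1 := ((tendsto_pow_const_mul_const_pow_of_abs_lt_one d hr).comp
    (tendsto_add_atTop_nat 1)).const_mul (A * Real.exp δ)
  rw [mul_zero] at h1
  refine h1.congr fun n => ?_
  simp only [Function.comp_apply, ← Real.exp_nat_mul]
  have : Real.exp (-δ * n) = Real.exp δ * Real.exp (((n + 1 : ℕ) : ℝ) * -δ) := by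
    rw [← Real.exp_add]
    congr 1
    push_cast
    ring
  rw [this]
  push_cast
  ring

/-- A statistic that is exponentially concentrated around `C n` has expectation `~ C n`. -/
theorem isEquivalent_of_concentration {α : ℕ → Type*} (s : ∀ n, Finset (α n))
    (X : ∀ n, α n → ℝ) {C K R A : ℝ} {d : ℕ} (hC : 0 < C) (hR : 0 < R)
    (hX : ∀ᶠ n in atTop, ∀ π ∈ s n, |X n π - C * n| ≤ K * n)
    (hlow : ∀ᶠ n : ℕ in atTop, R ^ n ≤ A * ((n : ℝ) + 1) ^ d * (s n).card)
    (hbad : ∀ ε : ℝ, 0 < ε → ε ≤ 1 → ∃ (B δ : ℝ) (d' : ℕ), 0 < δ ∧ ∀ᶠ n : ℕ in atTop,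
      (((s n).filter fun π => ε * n < |X n π - C * n|).card : ℝ) ≤
        B * ((n : ℝ) + 1) ^ d' * R ^ n * Real.exp (-δ * n)) :
    (fun n : ℕ => 𝔼 π ∈ s n, X n π) ~[atTop] fun n : ℕ => C * n := by
  refine IsLittleO.of_bound fun c hc => ?_
  -- One share ε n of the error comes from the typical elements. Another bounds the atypical ones,
  -- which are exponentially rare and deviate by at most K n. Together 2 ε n ≤ c C n.
  set ε : ℝ := min 1 (c * C / 2) with hε
  have hε0 : 0 < ε := lt_min one_pos (by positivity)
  obtain ⟨B, δ, d', hδ, hbad'⟩ := hbad ε hε0 (min_le_left _ _)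
  have hlim := tendsto_pow_mul_exp_neg (|K| * |B| * |A|) (d' + d) hδ
  filter_upwards [hX, hlow, hbad', hlim.eventually (ge_mem_nhds hε0)] with n hX hlow hbad hlim
  have hn0 : (0 : ℝ) ≤ n := Nat.cast_nonneg n
  have hRn : 0 < R ^ n := pow_pos hR n
  have hs : (0 : ℝ) < (s n).card := by
    rcases Nat.eq_zero_or_pos (s n).card with h | h
    · rw [h, Nat.cast_zero, mul_zero] at hlow
      linarith
    · exact_mod_cast h
  set b : ℝ := (((s n).filter fun π => ε * n < |X n π - C * n|).card : ℝ) with hb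
  have h1 : |K| * b ≤ ε * (s n).card := by
    have h2 : |K| * b * R ^ n ≤ ε * (s n).card * R ^ n := by
      calc |K| * b * R ^ n
          ≤ |K| * (|B| * ((n : ℝ) + 1) ^ d' * R ^ n * Real.exp (-δ * n)) *
            (|A| * ((n : ℝ) + 1) ^ d * (s n).card) := by
            refine mul_le_mul (mul_le_mul_of_nonneg_left (hbad.trans ?_) (abs_nonneg _))
              (hlow.trans ?_) hRn.le (by positivity)
            · gcongr
              exact le_abs_self B
            · gcongr
              exact le_abs_self A
        _ = (|K| * |B| * |A| * ((n : ℝ) + 1) ^ (d' + d) * Real.exp (-δ * n)) *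
            ((s n).card * R ^ n) := by ring
        _ ≤ ε * ((s n).card * R ^ n) := mul_le_mul_of_nonneg_right hlim (by positivity)
        _ = _ := by ring
    exact le_of_mul_le_mul_right h2 hRn
  have h2 : (𝔼 π ∈ s n, X n π) - C * n = (∑ π ∈ s n, (X n π - C * n)) / (s n).card := by
    rw [expect_eq_sum_div_card, sum_sub_distrib, sum_const, nsmul_eq_mul, sub_div,
      mul_div_cancel_left₀ _ hs.ne']
  have h3 : |∑ π ∈ s n, (X n π - C * n)| ≤ (2 * ε * n) * (s n).card := by
    calc |∑ π ∈ s n, (X n π - C * n)| ≤ ∑ π ∈ s n, |X n π - C * n| := abs_sum_le_sum_abs _ _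
      _ ≤ ∑ π ∈ s n, (ε * n + if ε * n < |X n π - C * n| then |K| * n else 0) := by
          refine sum_le_sum fun π hπ => ?_
          split_ifs with h
          · have h4 := hX π hπ
            have h5 : K * n ≤ |K| * n := mul_le_mul_of_nonneg_right (le_abs_self K) hn0
            have h6 : 0 ≤ ε * n := by positivity
            linarith
          · linarith
      _ = (s n).card * (ε * n) + b * (|K| * n) := by
          rw [sum_add_distrib, sum_const, ← sum_filter, sum_const, nsmul_eq_mul, nsmul_eq_mul]
      _ = (s n).card * (ε * n) + (|K| * b) * n := by ring
      _ ≤ (s n).card * (ε * n) + (ε * (s n).card) * n := by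
          have := mul_le_mul_of_nonneg_right h1 hn0
          linarith
      _ = _ := by ring
  have h4 : ε ≤ c * C / 2 := min_le_right _ _
  simp only [Pi.sub_apply, Real.norm_eq_abs]
  rw [h2, abs_div, abs_of_pos hs, div_le_iff₀ hs,
    abs_of_nonneg (show 0 ≤ C * n by positivity)]
  refine h3.trans (mul_le_mul_of_nonneg_right ?_ hs.le)
  nlinarith

lemma count_le {m : ℕ} (w : Fin m → ℕ) (s : ℕ) : count w s ≤ m :=
  (card_le_univ _).trans (by simp)

/-- If the elements of `s n` are encoded by almost divisible words and polynomially many further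
data, and if there are at least as many of them as ballot words, then the statistic `X` behaves
like the number of entries equal to `t * k` in a random word. -/
theorem isEquivalent_of_encoding {k : ℕ} (hk : 0 < k) (t : ℕ) {α : ℕ → Type*}
    (s : ∀ n, Finset (α n)) (X : ∀ n, α n → ℕ) (i₀ j₀ e e' A d : ℕ)
    (henc : ∀ᶠ n : ℕ in atTop, ∃ (ι : Type) (_ : Fintype ι)
      (Φ : α n → ι × (Fin (k * (n - i₀)) → ℕ)), Fintype.card ι ≤ (A * (n + 1)) ^ d ∧
        Set.InjOn Φ (s n) ∧ ∀ π ∈ s n, (Φ π).2 ∈ almostDivisible k (k * (n - i₀)) e ∧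
          X n π ≤ count (Φ π).2 (t * k) + e' ∧ count (Φ π).2 (t * k) ≤ X n π + e')
    (hlow : ∀ᶠ n : ℕ in atTop,
      (ballotWords k (k * (n - j₀)) (n - j₀)).card ≤ (s n).card) :
    (fun n : ℕ => 𝔼 π ∈ s n, (X n π : ℝ)) ~[atTop]
      fun n : ℕ => (n : ℝ) * (k : ℝ) ^ 2 / ((k : ℝ) + 1) ^ (t + 1) := by
  have hk' : (1 : ℝ) ≤ k := by exact_mod_cast hk
  set C : ℝ := k * density k t with hCdef
  have hC : 0 < C := by
    rw [hCdef, density]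
    positivity
  have hG := growth_pos hk
  have hfun : (fun n : ℕ => (n : ℝ) * (k : ℝ) ^ 2 / ((k : ℝ) + 1) ^ (t + 1)) =
      fun n : ℕ => C * n := by
    funext n
    rw [hCdef, density, div_pow, one_pow, pow_succ]
    field_simp
    ring
  have hclose : ∀ n : ℕ, i₀ ≤ n → |C * n - density k t * (k * (n - i₀) : ℕ)| ≤ C * i₀ := by
    intro n hn
    have : C * n - density k t * (k * (n - i₀) : ℕ) = C * i₀ := by
      rw [hCdef]
      push_cast [Nat.cast_sub hn]
      ring
    rw [this, abs_of_nonneg (by positivity)]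
  rw [hfun]
  refine isEquivalent_of_concentration s (fun n π => (X n π : ℝ)) (K := k + e' + C)
    (R := growth k) (A := growth k ^ j₀ * (2 * k) ^ 2) (d := 2) hC hG ?_ ?_ ?_
  · filter_upwards [henc, eventually_ge_atTop 1] with n ⟨ι, _, Φ, _, _, hΦ⟩ hn π hπ
    have h1 : X n π ≤ k * n + e' := by
      refine (hΦ π hπ).2.1.trans (Nat.add_le_add_right ((count_le _ _).trans ?_) _)
      exact Nat.mul_le_mul_left _ (Nat.sub_le _ _)
    have h2 : (X n π : ℝ) ≤ k * n + e' := by exact_mod_cast h1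
    have h3 : (1 : ℝ) ≤ n := by exact_mod_cast hn
    have h4 : (0 : ℝ) ≤ X n π := Nat.cast_nonneg _
    have h5 : (0 : ℝ) ≤ e' := Nat.cast_nonneg _
    rw [abs_le]
    constructor <;> nlinarith
  · filter_upwards [hlow, eventually_gt_atTop j₀] with n hlow hn
    have h1 := growth_pow_le k (n - j₀) hk (by omega)
    have h2 : growth k ^ n = growth k ^ j₀ * growth k ^ (n - j₀) := by
      rw [← pow_add, Nat.add_sub_cancel' hn.le]
    have h3 : ((ballotWords k (k * (n - j₀)) (n - j₀)).card : ℝ) ≤ (s n).card := by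
      exact_mod_cast hlow
    have h4 : ((n - j₀ : ℕ) : ℝ) ≤ n := by exact_mod_cast Nat.sub_le _ _
    rw [h2]
    calc growth k ^ j₀ * growth k ^ (n - j₀)
        ≤ growth k ^ j₀ * (((2 * k : ℕ) * (((n - j₀ : ℕ) : ℝ) + 1)) ^ 2 *
          (ballotWords k (k * (n - j₀)) (n - j₀)).card) :=
          mul_le_mul_of_nonneg_left h1 (by positivity)
      _ ≤ growth k ^ j₀ * (((2 * k : ℕ) * ((n : ℝ) + 1)) ^ 2 * (s n).card) := by gcongr
      _ = _ := by
          push_cast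
          ring
  · intro ε hε hε1
    -- Since m ≤ k n, a deviation ε' m of the word is at most ε n / 2; for large n the other half
    -- absorbs the bounded errors e' and C i₀.
    set ε' : ℝ := ε / (2 * k) with hε'
    have hε'0 : 0 < ε' := by positivity
    have hε'1 : ε' ≤ 1 := by
      rw [hε', div_le_one (by positivity)]
      linarith
    set δ : ℝ := ε' ^ 2 / 8 * k with hδ
    refine ⟨(A : ℝ) ^ d * (2 * (8 * k / ε' ^ 2) ^ e) * Real.exp (δ * i₀) *
      max 1 (growth k)⁻¹ ^ i₀, δ, d, by positivity, ?_⟩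
    have hlarge : ∀ᶠ n : ℕ in atTop, (e' + C * i₀) * 2 / ε ≤ n :=
      (tendsto_natCast_atTop_atTop (R := ℝ)).eventually (eventually_ge_atTop _)
    filter_upwards [henc, hlarge, eventually_ge_atTop i₀] with n henc hn hi
    generalize hm : k * (n - i₀) = m at henc
    obtain ⟨ι, _, Φ, hι, hinj, hΦ⟩ := henc
    rw [div_le_iff₀ hε] at hn
    set W := (almostDivisible k m e).filter fun w => ε' * m ≤
      |(count w (t * k) : ℝ) - density k t * m| with hW
    have hm' : (m : ℝ) ≤ k * n := by
      have : m ≤ k * n := hm ▸ Nat.mul_le_mul_left _ (Nat.sub_le _ _)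
      exact_mod_cast this
    have h1 : ((s n).filter fun π => ε * n < |(X n π : ℝ) - C * n|).card ≤
        ((univ : Finset ι) ×ˢ W).card := by
      refine card_le_card_of_injOn Φ ?_ (hinj.mono fun π hπ => (mem_filter.1 hπ).1)
      intro π hπ
      rw [mem_coe, mem_filter] at hπ
      obtain ⟨hw, hx1, hx2⟩ := hΦ π hπ.1
      rw [mem_coe, mem_product, hW, mem_filter]
      refine ⟨mem_univ _, hw, ?_⟩
      have h2 : |(X n π : ℝ) - count (Φ π).2 (t * k)| ≤ e' := by
        have h3 : (X n π : ℝ) ≤ count (Φ π).2 (t * k) + e' := by exact_mod_cast hx1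
        have h4 : (count (Φ π).2 (t * k) : ℝ) ≤ X n π + e' := by exact_mod_cast hx2
        rw [abs_le]
        constructor <;> linarith
      have h3 := hclose n hi
      rw [hm] at h3
      have h4 : ε' * m ≤ ε * n / 2 := by
        rw [hε']
        calc ε / (2 * k) * m ≤ ε / (2 * k) * (k * n) :=
              mul_le_mul_of_nonneg_left hm' (by positivity)
          _ = ε * n / 2 := by field_simp
      have h5 := hπ.2
      have h6 : |(X n π : ℝ) - C * n| ≤ |(X n π : ℝ) - count (Φ π).2 (t * k)| +
          |(count (Φ π).2 (t * k) : ℝ) - density k t * m| +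
          |C * n - density k t * m| := by
        have h7 : (X n π : ℝ) - C * n = ((X n π : ℝ) - count (Φ π).2 (t * k)) +
          ((count (Φ π).2 (t * k) : ℝ) - density k t * m) + -(C * n - density k t * m) := by
          ring
        rw [h7, ← abs_neg (C * n - density k t * m)]
        exact abs_add_three _ _ _
      linarith
    rw [card_product, card_univ] at h1
    have h2 := card_deviation_le hk hm.symm e t hε'0 hε'1
    have h3 : (((s n).filter fun π => ε * n < |(X n π : ℝ) - C * n|).card : ℝ) ≤
        (Fintype.card ι : ℝ) * W.card := by exact_mod_cast h1
    have h4 : (Fintype.card ι : ℝ) ≤ ((A : ℝ) * (n + 1)) ^ d := by exact_mod_cast hι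
    have h5 : Real.exp (-(ε' ^ 2 / 8) * m) = Real.exp (δ * i₀) * Real.exp (-δ * n) := by
      rw [← Real.exp_add, ← hm, hδ]
      congr 1
      push_cast [Nat.cast_sub hi]
      ring
    have h6 : growth k ^ (n - i₀) ≤ max 1 (growth k)⁻¹ ^ i₀ * growth k ^ n := by
      have h7 : growth k ^ (n - i₀) = (growth k)⁻¹ ^ i₀ * growth k ^ n := by
        conv_rhs => rw [← Nat.sub_add_cancel hi, pow_add]
        rw [inv_pow]
        field_simp
      rw [h7]
      gcongr
      exact le_max_right _ _
    rw [h5] at h2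
    calc _ ≤ (Fintype.card ι : ℝ) * W.card := h3
      _ ≤ ((A : ℝ) * (n + 1)) ^ d * (2 * (8 * k / ε' ^ 2) ^ e *
          (max 1 (growth k)⁻¹ ^ i₀ * growth k ^ n) *
          (Real.exp (δ * i₀) * Real.exp (-δ * n))) := by
          refine mul_le_mul h4 (h2.trans ?_) (Nat.cast_nonneg _) (by positivity)
          gcongr
      _ = _ := by
          rw [mul_pow]
          ring

end Expectation

/-! ### Labels and their positions on the circle and the annulus -/

section Labels

lemma mem_signedSet {m : ℕ} {x : ℤ} : x ∈ signedSet m ↔ x ≠ 0 ∧ x.natAbs ≤ m := by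
  rw [signedSet, mem_erase, mem_Icc]
  omega

lemma neg_mem_signedSet {m : ℕ} {x : ℤ} : -x ∈ signedSet m ↔ x ∈ signedSet m := by
  rw [mem_signedSet, mem_signedSet]
  omega

lemma card_signedSet (m : ℕ) : (signedSet m).card = 2 * m := by
  rw [signedSet, card_erase_of_mem (by simp), Int.card_Icc]
  omega

lemma circlePos_lt {m : ℕ} {x : ℤ} (hx : x ∈ signedSet m) : circlePos m x < 2 * m := by
  rw [mem_signedSet] at hx
  unfold circlePos
  split_ifs <;> omega

lemma circlePos_injOn (m : ℕ) : Set.InjOn (circlePos m) (signedSet m) := by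
  intro x hx y hy h
  rw [mem_coe, mem_signedSet] at hx hy
  unfold circlePos at h
  split_ifs at h <;> omega

variable {k n : ℕ}

lemma mul_pred_add (hn : 0 < n) : k * (n - 1) + k = k * n := by
  obtain ⟨n, rfl⟩ : ∃ n', n = n' + 1 := ⟨n - 1, by omega⟩
  rw [Nat.add_sub_cancel, Nat.mul_succ]

lemma mem_innerSet {x : ℤ} :
    x ∈ innerSet k n ↔ k * (n - 1) < x.natAbs ∧ x.natAbs ≤ k * n := by
  rw [innerSet, Finset.mem_sdiff, outerSet, mem_signedSet, mem_signedSet]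
  omega

lemma innerPos_lt (hn : 0 < n) {x : ℤ} (hx : x ∈ innerSet k n) : innerPos k n x < 2 * k := by
  rw [mem_innerSet] at hx
  have := mul_pred_add (k := k) hn
  unfold innerPos
  split_ifs <;> omega

lemma innerPos_injOn (hn : 0 < n) : Set.InjOn (innerPos k n) (innerSet k n) := by
  intro x hx y hy h
  rw [mem_coe, mem_innerSet] at hx hy
  have := mul_pred_add (k := k) hn
  unfold innerPos at h
  split_ifs at h <;> omega

lemma add_mod_injOn {a L i j : ℕ} (hi : i < L) (hj : j < L) (h : (i + a) % L = (j + a) % L) :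
    i = j :=
  Nat.ModEq.eq_of_lt_of_lt (Nat.ModEq.add_right_cancel' a h) hi hj

lemma cutPos_lt_iff (hk : 0 < k) (hn : 1 < n) {a b : ℕ} {x : ℤ} :
    cutPos k n a b x < 2 * (k * (n - 1)) ↔ x ∈ outerSet k n := by
  have hM : 0 < k * (n - 1) := Nat.mul_pos hk (by omega)
  unfold cutPos
  split_ifs with h
  · simp only [h, iff_true]
    exact Nat.mod_lt _ (by omega)
  · simp [h]

lemma cutPos_lt (hk : 0 < k) (hn : 1 < n) (a b : ℕ) (x : ℤ) :
    cutPos k n a b x < 2 * (k * n) := by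
  have hM : 0 < k * (n - 1) := Nat.mul_pos hk (by omega)
  have := mul_pred_add (k := k) (n := n) (by omega)
  unfold cutPos
  split_ifs with h
  · have := Nat.mod_lt (circlePos (k * (n - 1)) x + a) (show 0 < 2 * (k * (n - 1)) by omega)
    omega
  · have := Nat.mod_lt (innerPos k n x + b) (show 0 < 2 * k by omega)
    omega

lemma cutPos_injOn (hk : 0 < k) (hn : 1 < n) (a b : ℕ) :
    Set.InjOn (cutPos k n a b) (signedSet (k * n)) := by
  intro x hx y hy h
  have h1 := cutPos_lt_iff hk hn (a := a) (b := b) (x := x)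
  have h2 := cutPos_lt_iff hk hn (a := a) (b := b) (x := y)
  rw [h, h2] at h1
  by_cases hxo : x ∈ outerSet k n
  · have hyo := h1.2 hxo
    unfold cutPos at h
    rw [if_pos hxo, if_pos hyo] at h
    exact circlePos_injOn _ hxo hyo (add_mod_injOn (circlePos_lt hxo) (circlePos_lt hyo) h)
  · have hyo : y ∉ outerSet k n := fun hy => hxo (h1.1 hy)
    have hxi : x ∈ innerSet k n := Finset.mem_sdiff.2 ⟨hx, hxo⟩
    have hyi : y ∈ innerSet k n := Finset.mem_sdiff.2 ⟨hy, hyo⟩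
    unfold cutPos at h
    rw [if_neg hxo, if_neg hyo] at h
    exact innerPos_injOn (by omega) hxi hyi
      (add_mod_injOn (innerPos_lt (by omega) hxi) (innerPos_lt (by omega) hyi) (Nat.add_left_cancel h))

/-- With the standard cut, |x| and the position of x differ by 1 modulo k, because every arc of
labels that precedes x is offset by a multiple of k. Condition (2) thus becomes a condition on gaps
between positions. -/
lemma cutPos_zero_add_one (hn : 1 < n) {x : ℤ} (hx : x ∈ signedSet (k * n)) :
    ∃ c : ℕ, cutPos k n 0 0 x + 1 = x.natAbs + k * c := by
  have hk := mul_pred_add (k := k) (n := n) (by omega)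
  unfold cutPos
  split_ifs with h
  · have h1 := circlePos_lt h
    rw [outerSet, mem_signedSet] at h
    rw [add_zero, Nat.mod_eq_of_lt h1]
    unfold circlePos
    split_ifs with h2
    · exact ⟨0, by omega⟩
    · exact ⟨n - 1, by omega⟩
  · have hxi : x ∈ innerSet k n := Finset.mem_sdiff.2 ⟨hx, h⟩
    have h1 := innerPos_lt (by omega) hxi
    rw [mem_innerSet] at hxi
    rw [add_zero, Nat.mod_eq_of_lt h1]
    unfold innerPos
    split_ifs with h2
    · exact ⟨n - 1, by omega⟩
    · exact ⟨n, by omega⟩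

end Labels

/-! ### Gaps of blocks in k-divisible non-crossing partitions -/

section Gap

variable {S : Finset ℤ} (π : Finpartition S) {pos : ℤ → ℕ} {k : ℕ}

/-- A set of labels that contains every block that it meets is `k`-divisible. -/
lemma dvd_card_of_saturated (hdiv : ∀ V ∈ π.parts, k ∣ V.card) {T : Finset ℤ} (hT : T ⊆ S)
    (hsat : ∀ V ∈ π.parts, ∀ z ∈ V, z ∈ T → V ⊆ T) : k ∣ T.card := by
  have h : T = (π.parts.filter (· ⊆ T)).biUnion id := by
    ext z
    simp only [mem_biUnion, mem_filter, id]
    constructor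
    · intro hz
      obtain ⟨V, hV, hzV⟩ := π.exists_mem (hT hz)
      exact ⟨V, ⟨hV, hsat V hV z hzV hz⟩, hzV⟩
    · rintro ⟨V, ⟨-, hVT⟩, hz⟩
      exact hVT hz
  rw [h, card_biUnion]
  · exact dvd_sum fun V hV => hdiv V (mem_filter.1 hV).1
  · intro V hV W hW hVW
    exact π.disjoint (mem_filter.1 hV).1 (mem_filter.1 hW).1 hVW

lemma card_filter_pos (hinj : Set.InjOn pos S) (hlt : ∀ x ∈ S, pos x < S.card) (I : Finset ℕ)
    (hI : I ⊆ range S.card) : (S.filter fun z => pos z ∈ I).card = I.card := by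
  have himg : S.image pos = range S.card :=
    eq_of_subset_of_card_le (fun i hi => by
      obtain ⟨x, hx, rfl⟩ := mem_image.1 hi
      exact mem_range.2 (hlt x hx)) (by rw [card_image_of_injOn hinj, card_range])
  rw [← card_image_of_injOn (hinj.mono (filter_subset _ _)) (f := pos)]
  congr 1
  ext i
  simp only [mem_image, mem_filter]
  constructor
  · rintro ⟨x, ⟨-, hx⟩, rfl⟩
    exact hx
  · intro hi
    have := hI hi
    rw [← himg, mem_image] at this
    obtain ⟨x, hx, rfl⟩ := this
    exact ⟨x, ⟨hx, hi⟩, rfl⟩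

/-- In a non-crossing partition with `k`-divisible blocks, the gaps of the blocks are
`k`-divisible. -/
lemma modEq_of_isNext (hnc : NonCrossing pos π.parts) (hdiv : ∀ V ∈ π.parts, k ∣ V.card)
    (hinj : Set.InjOn pos S) (hlt : ∀ x ∈ S, pos x < S.card) {V : Finset ℤ} (hV : V ∈ π.parts)
    {x y : ℤ} (h : IsNext pos V x y) : (k : ℤ) ∣ (pos x : ℤ) + 1 - pos y := by
  obtain ⟨hx, hy, h⟩ := h
  have hVS := π.subset hV
  have key : ∀ I ⊆ range S.card, (∀ W ∈ π.parts, ∀ z ∈ W, pos z ∈ I → ∀ w ∈ W, pos w ∈ I) →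
      k ∣ I.card := by
    intro I hI hsat
    rw [← card_filter_pos hinj hlt I hI]
    refine dvd_card_of_saturated π hdiv (filter_subset _ _) fun W hW z hz hzT w hw => ?_
    rw [mem_filter] at hzT ⊢
    exact ⟨π.subset hW hw, hsat W hW z hz hzT.2 w hw⟩
  have hne : ∀ W ∈ π.parts, W ≠ V → ∀ w ∈ W, pos w ≠ pos x ∧ pos w ≠ pos y := by
    intro W hW hWV w hw
    constructor
    · intro h
      have := hinj (π.subset hW hw) (hVS hx) h
      exact hWV (π.eq_of_mem_parts hW hV hw (this ▸ hx))
    · intro h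
      have := hinj (π.subset hW hw) (hVS hy) h
      exact hWV (π.eq_of_mem_parts hW hV hw (this ▸ hy))
  rcases h with ⟨hxy, hgap⟩ | ⟨hmax, hmin⟩
  -- The open gap between consecutive elements of V is a union of blocks: a block leaving it would
  -- cross V.
  · have h1 := key (Finset.Ioo (pos x) (pos y)) (fun i hi => by
      have := hlt y (hVS hy)
      rw [mem_Ioo] at hi
      rw [mem_range]
      omega) (by
      intro W hW z hz hzI w hw
      rw [mem_Ioo] at hzI ⊢
      have hWV : W ≠ V := by
        rintro rfl
        exact hgap z hz hzI
      obtain ⟨h2, h3⟩ := hne W hW hWV w hw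
      by_contra hcon
      rcases lt_or_gt_of_ne h2 with h4 | h4
      · exact hWV (hnc W hW V hV w hw x hx z hz y hy h4 hzI.1 hzI.2)
      · exact hWV (hnc V hV W hW x hx z hz y hy w hw hzI.1 hzI.2 (by omega)).symm)
    rw [Nat.card_Ioo] at h1
    have h2 : (pos x : ℤ) + 1 - pos y = -((pos y - pos x - 1 : ℕ) : ℤ) := by omega
    rw [h2, dvd_neg]
    exact_mod_cast h1
  -- For the wrap-around step the closed span of V, from its minimum y to its maximum x, is a union
  -- of blocks.
  · have h1 := key (Finset.Icc (pos y) (pos x)) (fun i hi => by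
      have := hlt x (hVS hx)
      rw [mem_Icc] at hi
      rw [mem_range]
      omega) (by
      intro W hW z hz hzI w hw
      rw [mem_Icc] at hzI ⊢
      by_cases hWV : W = V
      · subst hWV
        exact ⟨hmin w hw, hmax w hw⟩
      obtain ⟨h2, h3⟩ := hne W hW hWV w hw
      obtain ⟨h4, h5⟩ := hne W hW hWV z hz
      by_contra hcon
      rcases lt_or_gt_of_ne h3 with h6 | h6
      · exact hWV (hnc W hW V hV w hw y hy z hz x hx h6 (by omega) (by omega))
      · exact hWV (hnc V hV W hW y hy z hz x hx w hw (by omega) (by omega) (by omega)).symm)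
    rw [Nat.card_Icc] at h1
    have h2 : (pos x : ℤ) + 1 - pos y = ((pos x + 1 - pos y : ℕ) : ℤ) := by
      have := hmin x hx
      omega
    rw [h2]
    exact_mod_cast h1

end Gap

/-! ### Partitions into fibres and injections of ballot words -/

section Kernel

variable {β : Type*} [DecidableEq β]

instance (key : ℤ → β) : DecidableRel (Setoid.ker key).r := fun a b =>
  inferInstanceAs (Decidable (key a = key b))

/-- The partition of `S` into the fibres of `key`. -/
def kerPart (S : Finset ℤ) (key : ℤ → β) : Finpartition S :=
  Finpartition.ofSetSetoid (Setoid.ker key) S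

lemma mem_kerPart {S : Finset ℤ} {key : ℤ → β} {V : Finset ℤ} :
    V ∈ (kerPart S key).parts ↔ ∃ x ∈ S, V = S.filter fun y => key y = key x := by
  simp only [kerPart, Finpartition.ofSetSetoid_parts, mem_image, Setoid.ker_def]
  refine exists_congr fun x => and_congr_right fun _ => ?_
  rw [eq_comm]
  simp only [eq_comm (a := key x)]

lemma key_eq_of_mem_kerPart {S : Finset ℤ} {key : ℤ → β} {V : Finset ℤ}
    (hV : V ∈ (kerPart S key).parts) {x y : ℤ} (hx : x ∈ V) (hy : y ∈ V) : key x = key y := by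
  obtain ⟨z, hz, rfl⟩ := mem_kerPart.1 hV
  rw [mem_filter] at hx hy
  rw [hx.2, hy.2]

lemma kerPart_eq_of_key_eq {S : Finset ℤ} {key : ℤ → β} {V W : Finset ℤ}
    (hV : V ∈ (kerPart S key).parts) (hW : W ∈ (kerPart S key).parts) {x y : ℤ} (hx : x ∈ V)
    (hy : y ∈ W) (h : key x = key y) : V = W := by
  obtain ⟨z, hz, rfl⟩ := mem_kerPart.1 hV
  obtain ⟨w, hw, rfl⟩ := mem_kerPart.1 hW
  rw [mem_filter] at hx hy
  rw [← hx.2, h, hy.2]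

lemma mem_part_kerPart {S : Finset ℤ} {key : ℤ → β} {x y : ℤ} (hx : x ∈ S) (hy : y ∈ S) :
    y ∈ (kerPart S key).part x ↔ key x = key y := by
  rw [kerPart, Finpartition.mem_part_ofSetSetoid_iff_rel, Setoid.ker_def]
  simp [hx, hy]

lemma word_congr {m : ℕ} {β γ : Type*} [DecidableEq β] [DecidableEq γ] {κ : Fin m → β}
    {κ' : Fin m → γ} (h : ∀ x y, κ x = κ y ↔ κ' x = κ' y) : word κ = word κ' := by
  funext j
  have h1 : ∀ x, first κ x = first κ' x := fun x => by
    simp only [first, h]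
  simp only [word, h1]

lemma isBallot_of_mem {k N n : ℕ} {f : Fin N → ℕ} (hf : f ∈ ballotWords k N n) :
    IsBallot (scale k f) N := by
  classical exact (mem_filter.1 hf).2

/-- If the fibres of `key F` restrict to the blocks of the ballot word `F`, then a family of
partitions that contains all these fibre partitions is at least as large as the set of ballot
words. -/
lemma card_ballotWords_le {k N n : ℕ} (hk : 0 < k) {S : Finset ℤ} (C : Finset (Finpartition S))
    (key : (ℕ → ℕ) → ℤ → β) (hC : ∀ f ∈ ballotWords k N n, kerPart S (key (scale k f)) ∈ C)
    (hS : ∀ i < N, (i + 1 : ℤ) ∈ S)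
    (hkey : ∀ F : ℕ → ℕ, ∀ i < N, ∀ j < N,
      key F (i + 1 : ℤ) = key F (j + 1 : ℤ) ↔ opener F i = opener F j) :
    (ballotWords k N n).card ≤ C.card := by
  refine card_le_card_of_injOn (fun f => kerPart S (key (scale k f))) hC ?_
  intro f hf g hg h
  have hf' := isBallot_of_mem hf
  have hg' := isBallot_of_mem hg
  -- On the labels 1, …, N the partition induces the opener colouring up to renaming, and the word
  -- of that colouring is the ballot word itself.
  have hw : word (openerColouring (scale k f) N) = word (openerColouring (scale k g) N) := by
    refine word_congr fun i j => ?_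
    unfold openerColouring
    rw [← hkey _ _ i.2 _ j.2, ← hkey _ _ i.2 _ j.2, ← mem_part_kerPart (hS _ i.2) (hS _ j.2),
      ← mem_part_kerPart (hS _ i.2) (hS _ j.2)]
    simp only at h
    rw [h]
  ext j
  have := congrFun hw j
  rw [word_openerColouring hf', word_openerColouring hg'] at this
  simpa [scale, hk.ne'] using this

lemma dvd_card_opener {k N n : ℕ} {f : Fin N → ℕ} (hf : f ∈ ballotWords k N n) {j : ℕ}
    (hj : j < N) : k ∣ ((range N).filter fun x => opener (scale k f) x = j).card := by
  rw [card_opener (isBallot_of_mem hf) hj, scale, dif_pos hj]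
  exact Dvd.intro _ rfl

end Kernel

/-! ### Ballot words as partitions of types A, B and D -/

section LowerBounds

/-! ### Type A -/

lemma card_ballotWords_le_NCA {k : ℕ} (hk : 0 < k) (n : ℕ) :
    (ballotWords k (k * n) n).card ≤ (NCA k n).card := by
  classical
  refine card_ballotWords_le hk (NCA k n) (fun F x => opener F (x.toNat - 1)) ?_ ?_ ?_
  · intro f hf
    have hb := isBallot_of_mem hf
    rw [NCA, mem_filter]
    refine ⟨mem_univ _, ?_, ?_⟩
    · intro V hV W hW a ha b hb' c hc d hd hab hbc hcd
      have h1 := key_eq_of_mem_kerPart hV ha hc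
      have h2 := key_eq_of_mem_kerPart hW hb' hd
      have hmem := mem_Icc.1 (Finpartition.subset _ hV ha)
      have hmem' := mem_Icc.1 (Finpartition.subset _ hW hd)
      exact kerPart_eq_of_key_eq hV hW ha hb'
        (opener_nc hb (by omega) (by omega) (by omega) (by omega) h1 h2)
    · intro V hV
      obtain ⟨x, hx, rfl⟩ := mem_kerPart.1 hV
      rw [mem_Icc] at hx
      have hj : opener (scale k f) (x.toNat - 1) < k * n :=
        (opener_le _ _).trans_lt (by omega)
      convert dvd_card_opener hf hj using 1
      refine card_bij (fun y _ => y.toNat - 1) ?_ ?_ ?_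
      · intro y hy
        rw [mem_filter, mem_Icc] at hy
        rw [mem_filter, mem_range]
        exact ⟨by omega, hy.2⟩
      · intro y hy z hz h
        rw [mem_filter, mem_Icc] at hy hz
        omega
      · intro i hi
        rw [mem_filter, mem_range] at hi
        refine ⟨(i + 1 : ℤ), ?_, by omega⟩
        rw [mem_filter, mem_Icc]
        refine ⟨by omega, ?_⟩
        rw [← hi.2]
        congr 1
  · intro i hi
    rw [mem_Icc]
    omega
  · intro F i _ j _
    simp only [Int.toNat_natCast_add_one, Nat.add_sub_cancel]

/-! ### Types B and D -/

/-- The colour of a label: its sign and its opener, for labels of absolute value at most `m`; all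
other labels get the colour `none`. -/
def symKey (m : ℕ) (F : ℕ → ℕ) (x : ℤ) : Option (Bool × ℕ) :=
  if x.natAbs ≤ m then some (decide (0 < x), opener F (x.natAbs - 1)) else none

variable {m : ℕ} {F : ℕ → ℕ} {x y : ℤ}

lemma symKey_of_le (h : x.natAbs ≤ m) :
    symKey m F x = some (decide (0 < x), opener F (x.natAbs - 1)) := if_pos h

lemma symKey_eq_none : symKey m F x = none ↔ m < x.natAbs := by
  unfold symKey
  split_ifs with h <;> simp <;> omega

lemma symKey_eq (h : symKey m F x = symKey m F y) (hx : x.natAbs ≤ m) :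
    y.natAbs ≤ m ∧ (0 < x ↔ 0 < y) ∧ opener F (x.natAbs - 1) = opener F (y.natAbs - 1) := by
  have hy : y.natAbs ≤ m := by
    by_contra hy
    rw [symKey_eq_none.2 (not_le.1 hy), symKey_eq_none] at h
    omega
  rw [symKey_of_le hx, symKey_of_le hy] at h
  simp only [Option.some.injEq, Prod.mk.injEq, decide_eq_decide] at h
  exact ⟨hy, h.1, h.2⟩

lemma symKey_neg (hx : x ≠ 0) (hy : y ≠ 0) :
    symKey m F (-x) = symKey m F y ↔ symKey m F x = symKey m F (-y) := by
  have h1 : ((-x).natAbs) = x.natAbs := Int.natAbs_neg x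
  have h2 : ((-y).natAbs) = y.natAbs := Int.natAbs_neg y
  have h3 : (0 < -x ↔ 0 < y) ↔ (0 < x ↔ 0 < -y) := by omega
  by_cases hx' : x.natAbs ≤ m <;> by_cases hy' : y.natAbs ≤ m <;>
    simp only [symKey, h1, h2, hx', hy', if_true, if_false, reduceCtorEq, Option.some.injEq,
      Prod.mk.injEq, decide_eq_decide, h3]

/-- The small positive and the small negative labels occupy two windows of consecutive positions,
each carrying a copy of the opener colouring, and no other label lies in a window. Hence the class
of the remaining labels cannot separate two points of a window. The start `base` of the negative
window is kn in type B and k(n - 1) in type D. -/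
lemma symKey_nc {L base : ℕ} {pos : ℤ → ℕ} (hF : IsBallot F m) (hbase : m ≤ base)
    (hpos : ∀ x ∈ signedSet L, (x.natAbs ≤ m ∧ 0 < x ∧ pos x + 1 = x.natAbs) ∨
      (x.natAbs ≤ m ∧ x < 0 ∧ pos x + 1 = base + x.natAbs) ∨
      (m < x.natAbs ∧ m ≤ pos x ∧ (pos x < base ∨ base + m ≤ pos x))) :
    NonCrossing pos (kerPart (signedSet L) (symKey m F)).parts := by
  intro V hV W hW a ha b hb c hc d hd hab hbc hcd
  have h1 := key_eq_of_mem_kerPart hV ha hc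
  have h2 := key_eq_of_mem_kerPart hW hb hd
  have hpa := hpos a (Finpartition.subset _ hV ha)
  have hpb := hpos b (Finpartition.subset _ hW hb)
  have hpc := hpos c (Finpartition.subset _ hV hc)
  have hpd := hpos d (Finpartition.subset _ hW hd)
  have hb0 := (mem_signedSet.1 (Finpartition.subset _ hW hb)).1
  clear hpos
  refine kerPart_eq_of_key_eq hV hW ha hb ?_
  by_cases ham : a.natAbs ≤ m
  · obtain ⟨hcm, hac, hoac⟩ := symKey_eq h1 ham
    have hbm : b.natAbs ≤ m := by
      by_contra hbm
      rw [symKey_eq_none.2 (not_le.1 hbm), eq_comm, symKey_eq_none] at h2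
      rcases hpa with ⟨-, ha0, hpa⟩ | ⟨-, ha0, hpa⟩ | hpa <;> omega
    have hsign : 0 < a ↔ 0 < b := by
      have := symKey_eq h2 hbm
      rcases hpa with ⟨-, ha0, hpa⟩ | ⟨-, ha0, hpa⟩ | hpa <;> omega
    obtain ⟨hdm, hbd, hobd⟩ := symKey_eq h2 hbm
    rw [symKey_of_le ham, symKey_of_le hbm, decide_eq_decide.2 hsign,
      opener_nc hF (a := a.natAbs - 1) (b := b.natAbs - 1) (c := c.natAbs - 1)
        (d := d.natAbs - 1) (by omega) (by omega) (by omega) (by omega) hoac hobd]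
  · rw [symKey_eq_none.2 (not_le.1 ham), eq_comm, symKey_eq_none] at h1
    by_cases hbm : b.natAbs ≤ m
    · obtain ⟨hdm, hbd, hobd⟩ := symKey_eq h2 hbm
      exfalso
      omega
    · rw [symKey_eq_none.2 (not_le.1 ham), symKey_eq_none.2 (not_le.1 hbm)]

lemma symKey_neg_mem {L : ℕ} {V : Finset ℤ}
    (hV : V ∈ (kerPart (signedSet L) (symKey m F)).parts) :
    -V ∈ (kerPart (signedSet L) (symKey m F)).parts := by
  classical
  obtain ⟨x, hx, rfl⟩ := mem_kerPart.1 hV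
  refine mem_kerPart.2 ⟨-x, neg_mem_signedSet.2 hx, ?_⟩
  ext y
  rw [mem_neg', mem_filter, mem_filter, neg_mem_signedSet]
  refine and_congr_right fun hy => ?_
  rw [symKey_neg (mem_signedSet.1 hy).1 (mem_signedSet.1 hx).1]

/-- The sign is part of every colour other than `none`, so only the leftover class can be symmetric.
-/
lemma symKey_zero {L : ℕ} {V : Finset ℤ}
    (hV : V ∈ (kerPart (signedSet L) (symKey m F)).parts) (h0 : V = -V) :
    V = (signedSet L).filter fun x => m < x.natAbs := by
  classical
  obtain ⟨x, hx, hVx⟩ := mem_kerPart.1 hV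
  have hxV : x ∈ V := by
    rw [hVx]
    simp [hx]
  have hnV : -x ∈ V := by
    rw [h0, mem_neg', neg_neg]
    exact hxV
  have h1 := key_eq_of_mem_kerPart hV hxV hnV
  have hxm : m < x.natAbs := by
    by_contra hxm
    have h2 := (symKey_eq h1 (not_lt.1 hxm)).2.1
    have := (mem_signedSet.1 hx).1
    omega
  rw [hVx, symKey_eq_none.2 hxm]
  simp only [symKey_eq_none]

lemma symKey_dvd {k N n L : ℕ} {f : Fin N → ℕ} (hf : f ∈ ballotWords k N n) (hNL : N ≤ L)
    (hdvd : k ∣ 2 * (L - N)) {V : Finset ℤ}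
    (hV : V ∈ (kerPart (signedSet L) (symKey N (scale k f))).parts) : k ∣ V.card := by
  classical
  obtain ⟨x, hx, rfl⟩ := mem_kerPart.1 hV
  rw [mem_signedSet] at hx
  by_cases hxN : x.natAbs ≤ N
  · have hj : opener (scale k f) (x.natAbs - 1) < N := (opener_le _ _).trans_lt (by omega)
    convert dvd_card_opener hf hj using 1
    refine card_bij (fun y _ => y.natAbs - 1) ?_ ?_ ?_
    · intro y hy
      rw [mem_filter, mem_signedSet] at hy
      obtain ⟨h1, -, h2⟩ := symKey_eq hy.2.symm hxN
      rw [mem_filter, mem_range]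
      exact ⟨by omega, h2.symm⟩
    · intro y hy z hz h
      rw [mem_filter, mem_signedSet] at hy hz
      have h1 := symKey_eq hy.2.symm hxN
      have h2 := symKey_eq hz.2.symm hxN
      omega
    · intro i hi
      rw [mem_filter, mem_range] at hi
      have key : ∀ y : ℤ, y.natAbs = i + 1 → (0 < y ↔ 0 < x) →
          symKey N (scale k f) y = symKey N (scale k f) x := by
        intro y h1 h2
        rw [symKey_of_le hxN, symKey_of_le (by omega), h1, Nat.add_sub_cancel, hi.2,
          decide_eq_decide.2 h2]
      rcases lt_or_gt_of_ne hx.1 with h | h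
      · refine ⟨-(i + 1 : ℤ), ?_, by omega⟩
        rw [mem_filter, mem_signedSet]
        exact ⟨⟨by omega, by omega⟩, key _ (by omega) (by omega)⟩
      · refine ⟨(i + 1 : ℤ), ?_, by omega⟩
        rw [mem_filter, mem_signedSet]
        exact ⟨⟨by omega, by omega⟩, key _ (by omega) (by omega)⟩
  · have h : ((signedSet L).filter fun y => symKey N (scale k f) y = symKey N (scale k f) x) =
        signedSet L \ signedSet N := by
      ext y
      rw [mem_filter, Finset.mem_sdiff, symKey_eq_none.2 (not_le.1 hxN), symKey_eq_none,
        mem_signedSet, mem_signedSet]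
      omega
    have hsub : signedSet N ⊆ signedSet L := by
      intro y hy
      rw [mem_signedSet] at hy ⊢
      omega
    rw [h, card_sdiff_of_subset hsub, card_signedSet, card_signedSet, ← Nat.mul_sub]
    exact hdvd

lemma symKey_add_one {i j : ℕ} (hi : i < m) (hj : j < m) :
    symKey m F (i + 1 : ℤ) = symKey m F (j + 1 : ℤ) ↔ opener F i = opener F j := by
  have h1 : ∀ i : ℕ, ((i + 1 : ℤ)).natAbs = i + 1 := fun i => by omega
  have h2 : ∀ i : ℕ, decide (0 < (i + 1 : ℤ)) = true := fun i => by
    rw [decide_eq_true_eq]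
    omega
  rw [symKey_of_le (by rw [h1]; omega), symKey_of_le (by rw [h1]; omega), h1, h1, h2, h2]
  simp

lemma card_ballotWords_le_NCB {k : ℕ} (hk : 0 < k) (n : ℕ) :
    (ballotWords k (k * n) n).card ≤ (NCB k n).card := by
  classical
  refine card_ballotWords_le hk (NCB k n) (fun F => symKey (k * n) F) ?_ ?_
    (fun F i hi j hj => symKey_add_one hi hj)
  · intro f hf
    rw [NCB, mem_filter]
    refine ⟨mem_univ _, ⟨?_, fun V hV => symKey_neg_mem hV, ?_⟩, fun V hV =>
      symKey_dvd hf le_rfl (by simp) hV⟩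
    · refine symKey_nc (base := k * n) (isBallot_of_mem hf) le_rfl fun x hx => ?_
      rw [mem_signedSet] at hx
      unfold circlePos
      split_ifs <;> omega
    · intro V hV W hW hV0 hW0
      rw [symKey_zero hV hV0, symKey_zero hW hW0]
  · intro i hi
    rw [mem_signedSet]
    omega

/-- Using a word for n - 2 leaves 2k outer labels, which join the 2k inner ones in a zero-block. Its
presence gives condition (3) and makes condition (4) vacuous; shortening the word by 2k letters
costs only a constant factor in growth. -/
lemma card_ballotWords_le_NCD {k n : ℕ} (hk : 0 < k) (hn : 1 < n) :
    (ballotWords k (k * (n - 2)) (n - 2)).card ≤ (NCD k n).card := by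
  classical
  have hk1 := mul_pred_add (k := k) (n := n) (by omega)
  have hk2 := mul_pred_add (k := k) (n := n - 1) (by omega)
  rw [show n - 1 - 1 = n - 2 by omega] at hk2
  refine card_ballotWords_le hk (NCD k n) (fun F => symKey (k * (n - 2)) F) ?_ ?_
    (fun F i hi j hj => symKey_add_one hi hj)
  · intro f hf
    rw [NCD, mem_filter]
    refine ⟨mem_univ _, ?_⟩
    have hdvd : ∀ V ∈ (kerPart (signedSet (k * n))
        (symKey (k * (n - 2)) (scale k f))).parts, k ∣ V.card :=
      fun V hV => symKey_dvd hf (by omega) ⟨4, by omega⟩ hV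
    have hnc : NonCrossing (cutPos k n 0 0) (kerPart (signedSet (k * n))
        (symKey (k * (n - 2)) (scale k f))).parts := by
      have hout : ∀ x : ℤ, x ∈ outerSet k n → cutPos k n 0 0 x = circlePos (k * (n - 1)) x := by
        intro x hx
        rw [cutPos, if_pos hx, add_zero, Nat.mod_eq_of_lt (circlePos_lt hx)]
      refine symKey_nc (base := k * (n - 1)) (isBallot_of_mem hf) (by omega) fun x hx => ?_
      by_cases hxo : x ∈ outerSet k n
      · rw [hout x hxo]
        rw [outerSet, mem_signedSet] at hxo
        unfold circlePos
        split_ifs <;> omega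
      · have := (cutPos_lt_iff hk hn (a := 0) (b := 0)).not.2 hxo
        rw [outerSet, mem_signedSet] at hxo
        rw [mem_signedSet] at hx
        omega
    have hnone : ∀ V ∈ (kerPart (signedSet (k * n))
        (symKey (k * (n - 2)) (scale k f))).parts, ∀ x ∈ V, k * (n - 2) < x.natAbs →
        V = (signedSet (k * n)).filter fun x => k * (n - 2) < x.natAbs := by
      intro V hV x hx hxm
      obtain ⟨y, hy, rfl⟩ := mem_kerPart.1 hV
      rw [mem_filter, symKey_eq_none.2 hxm] at hx
      rw [← hx.2]
      simp only [symKey_eq_none]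
    have hMpos : 0 < k * (n - 1) := Nat.mul_pos hk (by omega)
    refine ⟨⟨0, 0, hnc, ?_⟩, fun V hV => symKey_neg_mem hV, ?_, ?_⟩
    · intro V hV x y hxy
      have h1 := modEq_of_isNext _ hnc hdvd (cutPos_injOn hk hn 0 0) (fun x _ => by
        rw [card_signedSet]
        exact cutPos_lt hk hn 0 0 x) hV hxy
      obtain ⟨c, hc⟩ := cutPos_zero_add_one hn (Finpartition.subset _ hV hxy.1)
      obtain ⟨d, hd⟩ := cutPos_zero_add_one hn (Finpartition.subset _ hV hxy.2.1)
      obtain ⟨e, he⟩ := h1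
      rw [Int.modEq_iff_dvd]
      refine ⟨e + d - c, ?_⟩
      rw [mul_sub, mul_add, ← he]
      zify at hc hd
      linarith
    · intro V hV h0
      rw [symKey_zero hV h0]
      constructor
      · intro x hx
        rw [mem_innerSet] at hx
        rw [mem_filter, mem_signedSet]
        omega
      · have : ({((k * (n - 1) : ℕ) : ℤ), -((k * (n - 1) : ℕ) : ℤ)} : Finset ℤ) ⊆
            ((signedSet (k * n)).filter fun x => k * (n - 2) < x.natAbs) ∩ outerSet k n := by
          intro x hx
          rw [mem_insert, mem_singleton] at hx
          rw [mem_inter, mem_filter, mem_signedSet, outerSet, mem_signedSet]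
          rcases hx with rfl | rfl <;> omega
        refine le_trans ?_ (card_le_card this)
        rw [card_pair (by omega)]
    · intro hall
      -- The leftover block contains both kn on the inner circle and k(n - 1) on the outer one.
      exfalso
      have hmem : ((k * n : ℕ) : ℤ) ∈ signedSet (k * n) := mem_signedSet.2 (by omega)
      obtain ⟨V, hV, hxV⟩ := (kerPart (signedSet (k * n))
        (symKey (k * (n - 2)) (scale k f))).exists_mem hmem
      have hVeq := hnone V hV _ hxV (by omega)
      have hyV : ((k * (n - 1) : ℕ) : ℤ) ∈ V := by
        rw [hVeq, mem_filter, mem_signedSet]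
        omega
      rcases hall V hV with h | h
      · have := h hyV
        rw [mem_innerSet] at this
        omega
      · have := h hxV
        rw [outerSet, mem_signedSet] at this
        omega
  · intro i hi
    rw [mem_signedSet]
    omega

end LowerBounds

/-! ### Cutting a symmetric non-crossing partition of the circle -/

section Circle

/-- The label at position `i` of the circle `1, …, M, -1, …, -M`, read periodically. -/
def lab (M : ℕ) (i : ℤ) : ℤ :=
  if i % (2 * M : ℕ) < M then i % (2 * M : ℕ) + 1 else M - 1 - i % (2 * M : ℕ)

variable {M : ℕ}

lemma emod_cases {L d : ℤ} (h0 : 0 ≤ d) (h : d < 2 * L) :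
    (d % L = d ∧ d < L) ∨ (d % L = d - L ∧ L ≤ d) := by
  rcases lt_or_ge d L with h1 | h1
  · exact Or.inl ⟨Int.emod_eq_of_lt h0 h1, h1⟩
  · refine Or.inr ⟨?_, h1⟩
    rw [← Int.sub_emod_right, Int.emod_eq_of_lt (by omega) (by omega)]

lemma lab_add (hM : 0 < M) (i : ℤ) : lab M (i + M) = -lab M i := by
  have h0 := Int.emod_nonneg i (show ((2 * M : ℕ) : ℤ) ≠ 0 by omega)
  have h1 := Int.emod_lt_of_pos i (show 0 < ((2 * M : ℕ) : ℤ) by omega)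
  have h2 : (i + M) % (2 * M : ℕ) = (i % (2 * M : ℕ) + M) % (2 * M : ℕ) := by
    rw [Int.emod_add_emod]
  have h3 := emod_cases (L := (2 * M : ℕ)) (d := i % (2 * M : ℕ) + M) (by omega) (by omega)
  unfold lab
  rw [h2]
  generalize i % (2 * M : ℕ) = r at *
  split_ifs <;> omega

lemma lab_sub (hM : 0 < M) (i : ℤ) : lab M (i - M) = -lab M i := by
  have := lab_add hM (i - M)
  rw [sub_add_cancel] at this
  rw [this, neg_neg]

lemma lab_add_two (hM : 0 < M) (i : ℤ) : lab M (i + 2 * M) = lab M i := by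
  rw [two_mul, ← add_assoc, lab_add hM, lab_add hM, neg_neg]

lemma lab_mem (hM : 0 < M) (i : ℤ) : lab M i ∈ signedSet M := by
  have h0 := Int.emod_nonneg i (show ((2 * M : ℕ) : ℤ) ≠ 0 by omega)
  have h1 := Int.emod_lt_of_pos i (show 0 < ((2 * M : ℕ) : ℤ) by omega)
  rw [mem_signedSet, lab]
  generalize i % (2 * M : ℕ) = r at *
  split_ifs <;> omega

lemma circlePos_lab (hM : 0 < M) (i : ℤ) : (circlePos M (lab M i) : ℤ) = i % (2 * M : ℕ) := by
  have h0 := Int.emod_nonneg i (show ((2 * M : ℕ) : ℤ) ≠ 0 by omega)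
  have h1 := Int.emod_lt_of_pos i (show 0 < ((2 * M : ℕ) : ℤ) by omega)
  unfold circlePos lab
  generalize i % (2 * M : ℕ) = r at *
  split_ifs <;> omega

lemma lab_emod (i : ℤ) : lab M (i % (2 * M : ℕ)) = lab M i := by
  unfold lab
  rw [Int.emod_emod_of_dvd _ dvd_rfl]

lemma lab_circlePos (hM : 0 < M) {x : ℤ} (hx : x ∈ signedSet M) : lab M (circlePos M x) = x := by
  refine circlePos_injOn M (lab_mem hM _) hx ?_
  have h1 := circlePos_lab hM (circlePos M x)
  have h2 := circlePos_lt hx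
  rw [Int.emod_eq_of_lt (by omega) (by omega)] at h1
  exact_mod_cast h1

lemma lab_injective_window (hM : 0 < M) {i j : ℤ} (h : lab M i = lab M j) (h1 : i < j + 2 * M)
    (h2 : j < i + 2 * M) : i = j := by
  have h3 := circlePos_lab hM i
  rw [h, circlePos_lab hM j] at h3
  have h5 : ((2 * M : ℕ) : ℤ) ∣ i - j := Int.ModEq.dvd (n := ((2 * M : ℕ) : ℤ)) h3
  obtain ⟨c, hc⟩ := h5
  have h6 : c = 0 := by
    push_cast at hc
    by_contra hne
    rcases lt_or_gt_of_ne hne with h7 | h7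
    · nlinarith
    · nlinarith
  rw [h6, mul_zero] at hc
  omega

lemma exists_lab (hM : 0 < M) (a : ℤ) {x : ℤ} (hx : x ∈ signedSet M) :
    ∃ i : Fin M, x = lab M (a + i) ∨ x = -lab M (a + i) := by
  set r := ((circlePos M x : ℤ) - a) % (2 * M : ℕ) with hr
  have h0 := Int.emod_nonneg (circlePos M x - a) (show ((2 * M : ℕ) : ℤ) ≠ 0 by omega)
  have h1 := Int.emod_lt_of_pos (circlePos M x - a) (show 0 < ((2 * M : ℕ) : ℤ) by omega)
  rw [← hr] at h0 h1
  have h2 : lab M (a + r) = x := by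
    rw [← lab_emod, hr, Int.add_emod_emod, add_sub_cancel, lab_emod, lab_circlePos hM hx]
  rcases lt_or_ge r M with h | h
  · refine ⟨⟨r.toNat, by omega⟩, Or.inl (h2.symm.trans ?_)⟩
    congr 1
    simp only [Int.toNat_of_nonneg h0]
  · refine ⟨⟨(r - M).toNat, by omega⟩, Or.inr (h2.symm.trans ?_)⟩
    rw [← lab_add hM]
    congr 1
    simp only [Int.toNat_of_nonneg (show 0 ≤ r - M by omega)]
    ring

/-- Non-crossing families of blocks on the circle, in terms of the periodic labelling. -/
def LiftNC (M : ℕ) (B : Finset (Finset ℤ)) : Prop :=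
  ∀ V ∈ B, ∀ W ∈ B, ∀ i j i' j' : ℤ, i < j → j < i' → i' < j' → j' < i + 2 * M →
    lab M i ∈ V → lab M j ∈ W → lab M i' ∈ V → lab M j' ∈ W → V = W

/-- A crossing is a cyclic pattern, so the place where the positions start is irrelevant. The offset
a admits the rotated positions of `cutPos`. -/
lemma liftNC_of_nonCrossing (hM : 0 < M) {B : Finset (Finset ℤ)} {pos : ℤ → ℕ} (a : ℤ)
    (hpos : ∀ i, (pos (lab M i) : ℤ) = (i + a) % (2 * M : ℕ)) (h : NonCrossing pos B) :
    LiftNC M B := by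
  intro V hV W hW i₁ i₂ i₃ i₄ h12 h23 h34 h41 hi₁ hi₂ hi₃ hi₄
  have hL : 0 < ((2 * M : ℕ) : ℤ) := by omega
  set q := (i₁ + a) / (2 * M : ℕ) with hq
  have hd₁ := Int.emod_add_mul_ediv (i₁ + a) (2 * M : ℕ)
  have hd0 := Int.emod_nonneg (i₁ + a) hL.ne'
  have hd1 := Int.emod_lt_of_pos (i₁ + a) hL
  rw [← hq] at hd₁
  have key : ∀ i, (pos (lab M i) : ℤ) = (i + a - (2 * M : ℕ) * q) % (2 * M : ℕ) := by
    intro i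
    rw [hpos, Int.sub_mul_emod_self_left]
  have c₁ : (pos (lab M i₁) : ℤ) = i₁ + a - (2 * M : ℕ) * q := by
    rw [hpos]
    omega
  have c₂ := emod_cases (L := (2 * M : ℕ)) (d := i₂ + a - (2 * M : ℕ) * q) (by omega) (by omega)
  have c₃ := emod_cases (L := (2 * M : ℕ)) (d := i₃ + a - (2 * M : ℕ) * q) (by omega) (by omega)
  have c₄ := emod_cases (L := (2 * M : ℕ)) (d := i₄ + a - (2 * M : ℕ) * q) (by omega) (by omega)
  rw [← key] at c₂ c₃ c₄
  generalize ((2 * M : ℕ) : ℤ) * q = z at *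
  -- The cases record how many of the last three points have passed the start of the circle; V and W
  -- exchange roles when this number is odd.
  rcases c₄ with ⟨c₄, c₄'⟩ | ⟨c₄, c₄'⟩
  · exact h V hV W hW _ hi₁ _ hi₂ _ hi₃ _ hi₄ (by omega) (by omega) (by omega)
  rcases c₃ with ⟨c₃, c₃'⟩ | ⟨c₃, c₃'⟩
  · exact (h W hW V hV _ hi₄ _ hi₁ _ hi₂ _ hi₃ (by omega) (by omega) (by omega)).symm
  rcases c₂ with ⟨c₂, c₂'⟩ | ⟨c₂, c₂'⟩
  · exact h V hV W hW _ hi₃ _ hi₄ _ hi₁ _ hi₂ (by omega) (by omega) (by omega)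
  · exact (h W hW V hV _ hi₂ _ hi₃ _ hi₄ _ hi₁ (by omega) (by omega) (by omega)).symm

variable {S : Finset ℤ} (π : Finpartition S)

/-- Cutting the circle at `a` and at the opposite place separates no block other than a
zero-block. -/
def IsCut (M : ℕ) (a : ℤ) : Prop :=
  ∀ V ∈ π.parts, ∀ i j : ℤ, a ≤ i → i < a + M → a + M ≤ j → j < a + 2 * M →
    lab M i ∈ V → lab M j ∈ V → V = -V

lemma eq_neg_of_mem (hneg : ∀ V ∈ π.parts, -V ∈ π.parts) {V : Finset ℤ} (hV : V ∈ π.parts)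
    {x : ℤ} (hx : x ∈ V) (hx' : -x ∈ V) : V = -V :=
  π.eq_of_mem_parts hV (hneg V hV) hx (mem_neg'.2 hx')

/-- The zero-block contains both a and its antipode, and a block meeting both sides of this diameter
would cross it. -/
lemma isCut_of_zero (hM : 0 < M) (hnc : LiftNC M π.parts) {V : Finset ℤ} (hV : V ∈ π.parts)
    (h0 : V = -V) {a : ℤ} (ha : lab M a ∈ V) : IsCut π M a := by
  intro W hW i j hi hi' hj hj' hiW hjW
  have haM : lab M (a + M) ∈ V := by
    rw [lab_add hM, h0, mem_neg', neg_neg]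
    exact ha
  have hWV : W = V := by
    rcases hi.eq_or_lt with rfl | hi
    · exact π.eq_of_mem_parts hW hV hiW ha
    rcases hj.eq_or_lt with rfl | hj
    · exact π.eq_of_mem_parts hW hV hjW haM
    · exact (hnc V hV W hW a i (a + M) j hi hi' hj hj' ha hiW haM hjW).symm
  rw [hWV]
  exact h0

/-- Without a zero-block on the circle, the cut is placed at the start of a longest chord, among the
chords shorter than half the circle that join two points of one block. -/
lemma isCut_of_maximal (hM : 0 < M) (hneg : ∀ V ∈ π.parts, -V ∈ π.parts)
    (hnc : LiftNC M π.parts) (hzero : ∀ V ∈ π.parts, ∀ i, lab M i ∈ V → V ≠ -V)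
    {V : Finset ℤ} (hV : V ∈ π.parts) {a d : ℤ} (hd : 0 ≤ d) (hdM : d < M) (ha : lab M a ∈ V)
    (had : lab M (a + d) ∈ V)
    (hmax : ∀ W ∈ π.parts, ∀ i j : ℤ, i ≤ j → j < i + M → lab M i ∈ W → lab M j ∈ W → j ≤ i + d) :
    IsCut π M a := by
  have hVz := hzero V hV a ha
  -- A short chord from u to i over the cut has length at most d, so it ends before a + d and forces
  -- W = V. Then the chord from u to a + d is either longer than d, against maximality, or reaches u
  -- + M, in which case V and -V meet or cross.
  have near : ∀ W ∈ π.parts, ∀ u i, a - M ≤ u → u < a → a ≤ i → i < u + M →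
      lab M u ∈ W → lab M i ∈ W → False := by
    intro W hW u i hu hua hai hiu huW hiW
    have h1 := hmax W hW u i (by omega) hiu huW hiW
    have hWV : W = V := by
      rcases hai.eq_or_lt with rfl | hai
      · exact π.eq_of_mem_parts hW hV hiW ha
      · exact hnc W hW V hV u a i (a + d) hua hai (by omega) (by omega) huW ha hiW had
    subst hWV
    rcases lt_or_ge (a + d) (u + M) with h2 | h2
    · have := hmax W hW u (a + d) (by omega) h2 huW had
      omega
    have huM : lab M (u + M) ∈ -W := by
      rw [lab_add hM, mem_neg', neg_neg]
      exact huW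
    have haM : lab M (a + M) ∈ -W := by
      rw [lab_add hM, mem_neg', neg_neg]
      exact ha
    refine hVz ?_
    rcases (show a ≤ u + M by omega).eq_or_lt with h3 | h3
    · rw [← h3] at huM
      exact π.eq_of_mem_parts hV (hneg W hV) ha huM
    rcases h2.eq_or_lt with h4 | h4
    · rw [h4] at huM
      exact π.eq_of_mem_parts hV (hneg W hV) had huM
    · exact hnc W hV (-W) (hneg W hV) a (u + M) (a + d) (a + M) h3 h4 (by omega) (by omega) ha
        huM had haM
  intro W hW i j hi hi' hj hj' hiW hjW
  exfalso
  have hu : lab M (j - 2 * M) ∈ W := by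
    rw [← lab_add_two hM, sub_add_cancel]
    exact hjW
  -- With j moved one turn back, the chord is short, or a diameter, or more than half the circle; in
  -- the last case the block -W has the short chord from i - M to j - M.
  rcases lt_trichotomy i (j - 2 * M + M) with h | h | h
  · exact near W hW (j - 2 * M) i (by omega) (by omega) hi h hu hiW
  · rw [h, lab_add hM] at hiW
    exact hzero W hW _ hu (eq_neg_of_mem π hneg hW hu hiW)
  · refine near (-W) (hneg W hW) (i - M) (j - M) (by omega) (by omega) (by omega) (by omega) ?_ ?_
    · rw [lab_sub hM, mem_neg', neg_neg]
      exact hiW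
    · rw [lab_sub hM, mem_neg', neg_neg]
      exact hjW

lemma exists_isCut (hM : 0 < M) (hS : signedSet M ⊆ S) (hneg : ∀ V ∈ π.parts, -V ∈ π.parts)
    (hnc : LiftNC M π.parts) : ∃ a : Fin (2 * M), IsCut π M a := by
  have hfin : ∀ i : ℤ, ∃ a : Fin (2 * M), ∃ c : ℤ, i = a + 2 * M * c := by
    intro i
    have h0 := Int.emod_nonneg i (show ((2 * M : ℕ) : ℤ) ≠ 0 by omega)
    have h1 := Int.emod_lt_of_pos i (show 0 < ((2 * M : ℕ) : ℤ) by omega)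
    have h2 := Int.emod_add_mul_ediv i (2 * M : ℕ)
    refine ⟨⟨(i % (2 * M : ℕ)).toNat, by omega⟩, i / (2 * M : ℕ), ?_⟩
    simp only [Int.toNat_of_nonneg h0]
    push_cast at h2 ⊢
    exact h2.symm
  have hper : ∀ i c : ℤ, lab M (i + 2 * M * c) = lab M i := by
    intro i c
    rw [← lab_emod]
    conv_rhs => rw [← lab_emod]
    push_cast
    rw [Int.add_mul_emod_self_left]
  by_cases hz : ∃ V ∈ π.parts, ∃ i, lab M i ∈ V ∧ V = -V
  · obtain ⟨V, hV, i, hi, h0⟩ := hz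
    obtain ⟨a, c, rfl⟩ := hfin i
    rw [hper] at hi
    exact ⟨a, isCut_of_zero π hM hnc hV h0 hi⟩
  · have hzero : ∀ V ∈ π.parts, ∀ i, lab M i ∈ V → V ≠ -V :=
      fun V hV i hi h => hz ⟨V, hV, i, hi, h⟩
    obtain ⟨p, hp, hpmax⟩ := exists_max_image
      ((univ : Finset (Fin (2 * M) × Fin M)).filter fun p =>
        π.part (lab M p.1) = π.part (lab M (p.1 + p.2))) (fun p => p.2)
      ⟨(⟨0, by omega⟩, ⟨0, hM⟩), by simp⟩
    rw [mem_filter] at hp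
    refine ⟨p.1, isCut_of_maximal π hM hneg hnc hzero
      (π.part_mem.2 (hS (lab_mem hM p.1))) (d := p.2) (by omega) (by omega)
      (π.mem_part_self.2 (hS (lab_mem hM p.1))) ?_ ?_⟩
    · rw [hp.2]
      exact π.mem_part_self.2 (hS (lab_mem hM _))
    · intro W hW i j hij hji hi hj
      obtain ⟨a, c, rfl⟩ := hfin i
      obtain ⟨e, rfl⟩ : ∃ e : ℕ, j = a + 2 * M * c + e := ⟨(j - (a + 2 * M * c)).toNat, by omega⟩
      rw [show (a : ℤ) + 2 * M * c + e = (a + e) + 2 * M * c by ring, hper] at hj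
      rw [hper] at hi
      have h1 := hpmax (a, ⟨e, by omega⟩) (by
        rw [mem_filter]
        refine ⟨mem_univ _, ?_⟩
        rw [π.part_eq_of_mem hW hi, π.part_eq_of_mem hW hj])
      have h2 : e ≤ (p.2 : ℕ) := h1
      omega

end Circle

/-! ### Encoding symmetric partitions by words and bounded side data -/

section Encoding

/-- Two partitions are equal if labels in the same block of one are in the same block of the
other, and conversely. -/
lemma finpartition_ext {S : Finset ℤ} {π π' : Finpartition S}
    (h : ∀ x ∈ S, ∀ y ∈ S, π.part x = π.part y ↔ π'.part x = π'.part y) : π = π' := by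
  have hpart : ∀ x ∈ S, π.part x = π'.part x := by
    intro x hx
    ext y
    constructor
    · intro hy
      have hyS := π.part_subset x hy
      rw [π'.mem_part_iff_part_eq_part hyS hx, ← h y hyS x hx]
      exact (π.mem_part_iff_part_eq_part hyS hx).1 hy
    · intro hy
      have hyS := π'.part_subset x hy
      rw [π.mem_part_iff_part_eq_part hyS hx, h y hyS x hx]
      exact (π'.mem_part_iff_part_eq_part hyS hx).1 hy
  have hsub : ∀ {π π' : Finpartition S}, (∀ x ∈ S, π.part x = π'.part x) →
      π.parts ⊆ π'.parts := by
    intro π π' hpart V hV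
    obtain ⟨x, hx⟩ := π.nonempty_of_mem_parts hV
    have hxS := π.subset hV hx
    rw [← π.part_eq_of_mem hV hx, hpart x hxS]
    exact π'.part_mem.2 hxS
  exact Finpartition.ext (Subset.antisymm (hsub hpart) (hsub fun x hx => (hpart x hx).symm))

/-- Partitions of `[±L]` whose trace on the circle with the labels `[±M]` is non-crossing, that
are invariant under negation, have at most one zero-block and `k`-divisible blocks. -/
structure IsSym (k M : ℕ) {L : ℕ} (π : Finpartition (signedSet L)) : Prop where
  neg_mem : ∀ V ∈ π.parts, -V ∈ π.parts
  zero_unique : ∀ V ∈ π.parts, ∀ W ∈ π.parts, V = -V → W = -W → V = W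
  nc : LiftNC M π.parts
  dvd : ∀ V ∈ π.parts, k ∣ V.card

/-- The colouring of half of the circle by the blocks. -/
noncomputable def halfColouring {L : ℕ} (M : ℕ) (π : Finpartition (signedSet L)) (a : ℤ) (i : Fin M) :
    Finset ℤ := π.part (lab M (a + i))

open Classical in
/-- A representative of a block, on the circle if possible. -/
noncomputable def repr (M : ℕ) (V : Finset ℤ) : ℤ :=
  if h : (V ∩ signedSet M).Nonempty then h.choose else if h : V.Nonempty then h.choose else 0

open Classical in
/-- A position in the zero-block, if there is one. -/
noncomputable def zeroMark {M : ℕ} (κ : Fin M → Finset ℤ) : Option (Fin M) :=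
  if h : ∃ i, κ i = -κ i then some h.choose else none

lemma repr_mem {M : ℕ} {V : Finset ℤ} (h : V.Nonempty) : repr M V ∈ V := by
  classical
  unfold repr
  split_ifs with h1
  · exact (mem_inter.1 h1.choose_spec).1
  · exact h.choose_spec

lemma repr_mem_signedSet {M : ℕ} {V : Finset ℤ} {x : ℤ} (hx : x ∈ V) (hx' : x ∈ signedSet M) :
    repr M V ∈ signedSet M := by
  classical
  unfold repr
  have h1 : (V ∩ signedSet M).Nonempty := ⟨x, mem_inter.2 ⟨hx, hx'⟩⟩
  rw [dif_pos h1]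
  exact (mem_inter.1 h1.choose_spec).2

lemma zeroMark_spec {M : ℕ} {κ : Fin M → Finset ℤ} {i : Fin M} (h : zeroMark κ = some i) :
    κ i = -κ i := by
  classical
  unfold zeroMark at h
  split_ifs at h with h1
  rw [← Option.some.inj h]
  exact h1.choose_spec

lemma exists_zeroMark {M : ℕ} {κ : Fin M → Finset ℤ} {i : Fin M} (h : κ i = -κ i) :
    ∃ j, zeroMark κ = some j := by
  classical
  have h1 : ∃ i, κ i = -κ i := ⟨i, h⟩
  exact ⟨h1.choose, dif_pos h1⟩

variable {k M L : ℕ} {π π' : Finpartition (signedSet L)}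

lemma IsSym.part_neg (h : IsSym k M π) {x : ℤ} (hx : x ∈ signedSet L) :
    π.part (-x) = -π.part x :=
  π.part_eq_of_mem (h.neg_mem _ (π.part_mem.2 hx)) (mem_neg'.2 (by
    rw [neg_neg]
    exact π.mem_part_self.2 hx))

lemma signedSet_mono (hML : M ≤ L) : signedSet M ⊆ signedSet L := by
  intro x hx
  rw [mem_signedSet] at hx ⊢
  omega

lemma halfColouring_nc (hM : 0 < M) (hML : M ≤ L) (h : IsSym k M π) (a : ℤ) :
    IsNC (halfColouring M π a) := by
  have hS : ∀ i, lab M i ∈ signedSet L := fun i => signedSet_mono hML (lab_mem hM i)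
  intro i j i' j' hij hji hij' h1 h2
  unfold halfColouring at h1 h2 ⊢
  have := j'.2
  refine h.nc _ (π.part_mem.2 (hS _)) _ (π.part_mem.2 (hS _)) (a + i) (a + j) (a + i') (a + j')
    (by simpa using hij) (by simpa using hji) (by simpa using hij') (by omega)
    (π.mem_part_self.2 (hS _)) (π.mem_part_self.2 (hS _)) ?_ ?_
  · rw [h1]
    exact π.mem_part_self.2 (hS _)
  · rw [h2]
    exact π.mem_part_self.2 (hS _)

/-- A block that meets both halves of a cut circle is a zero-block. -/
lemma IsCut.eq_neg (hM : 0 < M) {a : ℤ} (ha : IsCut π M a) {V : Finset ℤ} (hV : V ∈ π.parts)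
    {i j : Fin M} (hi : lab M (a + i) ∈ V) (hj : -lab M (a + j) ∈ V) : V = -V := by
  have h1 := i.2
  have h2 := j.2
  refine ha V hV (a + i) (a + j + M) (by omega) (by omega) (by omega) (by omega) hi ?_
  rw [lab_add hM]
  exact hj

section Injectivity

variable (hM : 0 < M) (hML : M ≤ L) (h : IsSym k M π) (h' : IsSym k M π') {a : ℤ}
  (ha : IsCut π M a) (hw : word (halfColouring M π a) = word (halfColouring M π' a))
  (hz : zeroMark (halfColouring M π a) = zeroMark (halfColouring M π' a))
  (hr : ∀ x ∈ signedSet L, x ∉ signedSet M → repr M (π.part x) = repr M (π'.part x))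

include hM hML h h' ha hw hz in
-- The word fixes the partition of one half, and negation transports it to the other. Labels of
-- opposite halves share a block only in the zero-block, which the mark identifies.
lemma part_eq_of_outer {x y : ℤ} (hx : x ∈ signedSet M) (hy : y ∈ signedSet M)
    (hxy : π.part x = π.part y) : π'.part x = π'.part y := by
  have hS : ∀ i, lab M i ∈ signedSet L := fun i => signedSet_mono hML (lab_mem hM i)
  have hker := ker_eq_of_word_eq (halfColouring_nc hM hML h a) (halfColouring_nc hM hML h' a) hw
  have opp : ∀ i j : Fin M, π.part (lab M (a + i)) = π.part (-lab M (a + j)) →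
      π'.part (lab M (a + i)) = π'.part (-lab M (a + j)) := by
    intro i j hij
    have hV := π.part_mem.2 (hS (a + i))
    have hi := π.mem_part_self.2 (hS (a + i))
    have hj : -lab M (a + j) ∈ π.part (lab M (a + i)) := by
      rw [hij]
      exact π.mem_part_self.2 (neg_mem_signedSet.2 (hS _))
    have h0 := ha.eq_neg hM hV hi hj
    have hj' : halfColouring M π a j = halfColouring M π a i := by
      refine π.part_eq_of_mem hV ?_
      have h1 : lab M (a + j) ∈ -π.part (lab M (a + i)) := mem_neg'.2 hj
      rwa [← h0] at h1
    obtain ⟨l, hl⟩ := exists_zeroMark (κ := halfColouring M π a) (i := i) h0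
    have hl' : halfColouring M π a i = halfColouring M π a l :=
      h.zero_unique _ hV _ (π.part_mem.2 (hS _)) h0 (zeroMark_spec hl)
    have h0' := zeroMark_spec (hz ▸ hl)
    rw [← (hker i l).1 hl'] at h0'
    have h1 := (hker j i).1 hj'
    unfold halfColouring at h0' h1
    rw [h'.part_neg (hS _), h1, ← h0']
  obtain ⟨i, rfl | rfl⟩ := exists_lab hM a hx <;> obtain ⟨j, rfl | rfl⟩ := exists_lab hM a hy
  · exact (hker i j).1 hxy
  · exact opp i j hxy
  · exact (opp j i hxy.symm).symm
  · rw [h.part_neg (hS _), h.part_neg (hS _), neg_inj] at hxy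
    rw [h'.part_neg (hS _), h'.part_neg (hS _), neg_inj]
    exact (hker i j).1 hxy

include hM hML h h' ha hw hz hr in
-- A label off the circle may be replaced by the recorded representative of its block. That
-- representative lies on the circle whenever the block meets it, which reduces mixed pairs to
-- `part_eq_of_outer`.
lemma part_eq_of_encoding {x y : ℤ} (hx : x ∈ signedSet L) (hy : y ∈ signedSet L)
    (hxy : π.part x = π.part y) : π'.part x = π'.part y := by
  have hrep : ∀ (π : Finpartition (signedSet L)) x, x ∈ signedSet L →
      π.part (repr M (π.part x)) = π.part x := fun π x hx =>
    π.part_eq_of_mem (π.part_mem.2 hx) (repr_mem (π.part_nonempty.2 hx))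
  have mixed : ∀ x ∈ signedSet L, x ∉ signedSet M → ∀ y ∈ signedSet M, π.part x = π.part y →
      π'.part x = π'.part y := by
    intro x hx hxM y hy hxy
    rw [← hrep π' x hx, ← hr x hx hxM]
    refine part_eq_of_outer hM hML h h' ha hw hz ?_ hy ?_
    · refine repr_mem_signedSet (x := y) ?_ hy
      rw [hxy]
      exact π.mem_part_self.2 (signedSet_mono hML hy)
    · rw [hrep π x hx, hxy]
  by_cases hxM : x ∈ signedSet M <;> by_cases hyM : y ∈ signedSet M
  · exact part_eq_of_outer hM hML h h' ha hw hz hxM hyM hxy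
  · exact (mixed y hy hyM x hxM hxy.symm).symm
  · exact mixed x hx hxM y hyM hxy
  · rw [← hrep π' x hx, ← hrep π' y hy, ← hr x hx hxM, ← hr y hy hyM, hxy]

end Injectivity

/-! ### Sizes of the blocks -/

/-- The zero-blocks and the blocks that contain labels outside the circle. -/
noncomputable def exceptional (M : ℕ) {L : ℕ} (π : Finpartition (signedSet L)) : Finset (Finset ℤ) :=
  (π.parts.filter fun V => V = -V) ∪ (signedSet L \ signedSet M).image π.part

lemma IsSym.card_exceptional_le (hML : M ≤ L) (h : IsSym k M π) :
    (exceptional M π).card ≤ 2 * (L - M) + 1 := by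
  unfold exceptional
  refine (card_union_le _ _).trans ?_
  have h1 : (π.parts.filter fun V => V = -V).card ≤ 1 := by
    rw [card_le_one]
    intro V hV W hW
    rw [mem_filter] at hV hW
    exact h.zero_unique V hV.1 W hW.1 hV.2 hW.2
  have h2 : ((signedSet L \ signedSet M).image π.part).card ≤ 2 * (L - M) := by
    refine card_image_le.trans ?_
    rw [card_sdiff_of_subset (signedSet_mono hML), card_signedSet, card_signedSet, Nat.mul_sub]
  omega

lemma ne_neg_of_not_exceptional {V : Finset ℤ} (hV : V ∈ π.parts) (hE : V ∉ exceptional M π) :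
    V ≠ -V := by
  intro h0
  exact hE (mem_union_left _ (mem_filter.2 ⟨hV, h0⟩))

lemma subset_of_not_exceptional {V : Finset ℤ} (hV : V ∈ π.parts) (hE : V ∉ exceptional M π) :
    V ⊆ signedSet M := by
  intro x hx
  by_contra hxM
  refine hE (mem_union_right _ (mem_image.2 ⟨x, Finset.mem_sdiff.2 ⟨π.subset hV hx, hxM⟩, ?_⟩))
  exact π.part_eq_of_mem hV hx

/-- A block on the circle that is not a zero-block lies entirely in one half, so the half colouring
sees all of it. -/
lemma IsCut.word_eq_card (hM : 0 < M) (hML : M ≤ L) {a : ℤ} (ha : IsCut π M a) {V : Finset ℤ}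
    (hV : V ∈ π.parts) (h0 : V ≠ -V) (hVM : V ⊆ signedSet M) {j : Fin M}
    (hj : halfColouring M π a j = V) (hfirst : first (halfColouring M π a) j = j) :
    word (halfColouring M π a) j = V.card := by
  have hS : ∀ i, lab M i ∈ signedSet L := fun i => signedSet_mono hML (lab_mem hM i)
  have hjV : lab M (a + j) ∈ V := by
    rw [← hj]
    exact π.mem_part_self.2 (hS _)
  rw [word_eq_of_first _ hfirst, hj]
  refine card_bij (fun i _ => lab M (a + i)) ?_ ?_ ?_
  · intro i hi
    rw [mem_filter] at hi
    rw [← hi.2]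
    exact π.mem_part_self.2 (hS _)
  · intro i _ i' _ hii
    have h1 := i.2
    have h2 := i'.2
    have := lab_injective_window hM hii (by omega) (by omega)
    exact Fin.ext (by omega)
  · intro x hx
    obtain ⟨i, rfl | rfl⟩ := exists_lab hM a (hVM hx)
    · exact ⟨i, mem_filter.2 ⟨mem_univ _, π.part_eq_of_mem hV hx⟩, rfl⟩
    · exact absurd (ha.eq_neg hM hV hjV hx) h0

lemma card_first_filter_le {m : ℕ} {β : Type*} [DecidableEq β] (κ : Fin m → β) (E : Finset β)
    (P : Fin m → Prop) [DecidablePred P] (hP : ∀ j, P j → first κ j = j ∧ κ j ∈ E) :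
    (univ.filter P).card ≤ E.card := by
  refine card_le_card_of_injOn κ ?_ ?_
  · intro j hj
    exact (hP j (mem_filter.1 hj).2).2
  · intro i hi j hj hij
    rw [← (hP i (mem_filter.1 hi).2).1, ← (hP j (mem_filter.1 hj).2).1]
    exact (first_eq_iff κ).2 hij

/-- A nonzero entry sits at the first position of a block and is that block's full size unless the
block is exceptional. -/
lemma IsSym.word_mem_almostDivisible (hM : 0 < M) (hML : M ≤ L) (h : IsSym k M π) {a : ℤ}
    (ha : IsCut π M a) :
    word (halfColouring M π a) ∈ almostDivisible k M (2 * (L - M) + 1) := by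
  rw [almostDivisible, mem_filter, mem_piAntidiag]
  refine ⟨⟨sum_word _, fun i _ => mem_univ i⟩, ?_⟩
  refine (card_first_filter_le (halfColouring M π a) (exceptional M π) _ ?_).trans
    (h.card_exceptional_le hML)
  intro j hj
  have hfirst : first (halfColouring M π a) j = j := by
    rw [← word_pos_iff]
    rcases Nat.eq_zero_or_pos (word (halfColouring M π a) j) with h0 | h0
    · rw [h0] at hj
      exact absurd (dvd_zero k) hj
    · exact h0
  refine ⟨hfirst, ?_⟩
  by_contra hE
  have hV : halfColouring M π a j ∈ π.parts :=
    π.part_mem.2 (signedSet_mono hML (lab_mem hM _))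
  rw [ha.word_eq_card hM hML hV (ne_neg_of_not_exceptional hV hE)
    (subset_of_not_exceptional hV hE) rfl hfirst] at hj
  exact hj (h.dvd _ hV)

lemma IsSym.card_union_neg (h : IsSym k M π) {V : Finset ℤ} (hV : V ∈ π.parts) (h0 : V ≠ -V) :
    (V ∪ -V).card = 2 * V.card := by
  have hd : Disjoint V (-V) := π.disjoint hV (h.neg_mem V hV) h0
  rw [card_union_of_disjoint hd, card_neg, two_mul]

/-- In each pair without exceptional members, V or -V meets the chosen half and is counted at its
first position there. -/
lemma IsSym.numPairs_le (hM : 0 < M) (hML : M ≤ L) (h : IsSym k M π) {a : ℤ}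
    (ha : IsCut π M a) (s : ℕ) :
    numPairs π s ≤ count (word (halfColouring M π a)) s + (2 * (L - M) + 1) := by
  set pr : Finset ℤ → Finset (Finset ℤ) := fun V => {V, -V} with hpr
  set κ := halfColouring M π a with hκ
  have key : ∀ V ∈ π.parts, V ≠ -V → V ⊆ signedSet M → V.card = s → ∀ i, κ i = V →
      pr V ∈ (univ.filter fun j => word κ j = s).image (pr ∘ κ) := by
    intro V hV h0 hVM hs i hi
    have h1 := apply_first κ i
    rw [hi] at h1
    refine mem_image.2 ⟨first κ i, mem_filter.2 ⟨mem_univ _, ?_⟩, ?_⟩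
    · rw [← hs]
      exact ha.word_eq_card hM hML hV h0 hVM h1 (first_first κ i)
    · rw [Function.comp_apply, h1]
  have hsub : (π.parts.filter fun V => (V ∪ -V).card = 2 * s).image pr ⊆
      (univ.filter fun j => word κ j = s).image (pr ∘ κ) ∪ (exceptional M π).image pr := by
    intro p hp
    rw [mem_image] at hp
    obtain ⟨V, hV, rfl⟩ := hp
    rw [mem_filter] at hV
    by_cases hE : V ∈ exceptional M π
    · exact mem_union_right _ (mem_image_of_mem _ hE)
    refine mem_union_left _ ?_
    have h0 := ne_neg_of_not_exceptional hV.1 hE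
    have hVM := subset_of_not_exceptional hV.1 hE
    have hs : V.card = s := by
      have := h.card_union_neg hV.1 h0
      omega
    obtain ⟨x, hx⟩ := π.nonempty_of_mem_parts hV.1
    obtain ⟨i, rfl | rfl⟩ := exists_lab hM a (hVM hx)
    · exact key V hV.1 h0 hVM hs i (π.part_eq_of_mem hV.1 hx)
    · have h1 : pr (-V) = pr V := by
        simp only [hpr, neg_neg]
        exact pair_comm _ _
      rw [← h1]
      refine key (-V) (h.neg_mem V hV.1) ?_ ?_ ?_ i ?_
      · rw [neg_neg]
        exact h0.symm
      · intro y hy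
        exact neg_mem_signedSet.1 (hVM (mem_neg'.1 hy))
      · rw [card_neg, hs]
      · exact π.part_eq_of_mem (h.neg_mem V hV.1) (mem_neg'.2 hx)
  refine (card_le_card hsub).trans ((card_union_le _ _).trans (Nat.add_le_add card_image_le ?_))
  exact card_image_le.trans (h.card_exceptional_le hML)

lemma IsSym.le_numPairs (hM : 0 < M) (hML : M ≤ L) (h : IsSym k M π) {a : ℤ}
    (ha : IsCut π M a) {s : ℕ} (hs : 0 < s) :
    count (word (halfColouring M π a)) s ≤ numPairs π s + (2 * (L - M) + 1) := by
  have hS : ∀ i, lab M i ∈ signedSet L := fun i => signedSet_mono hML (lab_mem hM i)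
  set κ := halfColouring M π a with hκ
  have hV : ∀ j, κ j ∈ π.parts := fun j => π.part_mem.2 (hS _)
  have hmem : ∀ j : Fin M, lab M (a + j) ∈ κ j := fun j => π.mem_part_self.2 (hS _)
  have hf : ∀ j, word κ j = s → first κ j = j := fun j hj =>
    (word_pos_iff κ).1 (by omega)
  have h1 : (univ.filter fun j => word κ j = s ∧ κ j ∈ exceptional M π).card ≤
      2 * (L - M) + 1 :=
    (card_first_filter_le κ (exceptional M π) _ fun j hj => ⟨hf j hj.1, hj.2⟩).trans
      (h.card_exceptional_le hML)
  have h2 : (univ.filter fun j => word κ j = s ∧ κ j ∉ exceptional M π).card ≤ numPairs π s := by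
    refine card_le_card_of_injOn (fun j => ({κ j, -κ j} : Finset (Finset ℤ))) ?_ ?_
    · intro j hj
      rw [mem_coe, mem_filter] at hj
      obtain ⟨-, hj, hE⟩ := hj
      refine mem_image.2 ⟨κ j, mem_filter.2 ⟨hV j, ?_⟩, rfl⟩
      have h0 := ne_neg_of_not_exceptional (hV j) hE
      rw [h.card_union_neg (hV j) h0, ← hj, ha.word_eq_card hM hML (hV j) h0
        (subset_of_not_exceptional (hV j) hE) rfl (hf j hj)]
    · intro i hi j hj hij
      rw [mem_coe, mem_filter] at hi hj
      have h3 : κ i ∈ ({κ j, -κ j} : Finset (Finset ℤ)) := by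
        simp only at hij
        rw [← hij]
        exact mem_insert_self _ _
      rw [mem_insert, mem_singleton] at h3
      rcases h3 with h3 | h3
      · rw [← hf i hi.2.1, ← hf j hj.2.1]
        exact (first_eq_iff κ).2 h3
      -- If two positions of the half carried V and -V, then V would meet both halves and be a
      -- zero-block.
      · exfalso
        refine ne_neg_of_not_exceptional (hV i) hi.2.2
          (ha.eq_neg hM (hV i) (hmem i) (j := j) ?_)
        rw [h3, mem_neg', neg_neg]
        exact hmem j
  have h3 : count (word κ) s = (univ.filter fun j => word κ j = s ∧ κ j ∈ exceptional M π).card +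
      (univ.filter fun j => word κ j = s ∧ κ j ∉ exceptional M π).card := by
    rw [count, ← filter_filter, ← filter_filter, card_filter_add_card_filter_not]
  omega

/-- Symmetric non-crossing partitions are encoded by almost divisible words and polynomially many
further data. -/
theorem exists_encoding (hM : 0 < M) (hML : M ≤ L) (C : Finset (Finpartition (signedSet L)))
    (hC : ∀ π ∈ C, IsSym k M π) :
    ∃ (ι : Type) (_ : Fintype ι) (Φ : Finpartition (signedSet L) → ι × (Fin M → ℕ)),
      Fintype.card ι ≤ (2 * L) ^ (2 * (L - M) + 2) ∧ Set.InjOn Φ C ∧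
      ∀ π ∈ C, (Φ π).2 ∈ almostDivisible k M (2 * (L - M) + 1) ∧ ∀ s, 0 < s →
        numPairs π s ≤ count (Φ π).2 s + (2 * (L - M) + 1) ∧
        count (Φ π).2 s ≤ numPairs π s + (2 * (L - M) + 1) := by
  classical
  have hcut : ∀ π : Finpartition (signedSet L), ∃ a : Fin (2 * M), π ∈ C → IsCut π M a := by
    intro π
    by_cases hπ : π ∈ C
    · obtain ⟨a, ha⟩ := exists_isCut π hM (signedSet_mono hML) (hC π hπ).neg_mem (hC π hπ).nc
      exact ⟨a, fun _ => ha⟩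
    · exact ⟨⟨0, by omega⟩, fun h => absurd h hπ⟩
  choose a ha using hcut
  refine ⟨(Fin (2 * M) × Option (Fin M)) ×
    ({x // x ∈ signedSet L \ signedSet M} → {x // x ∈ signedSet L}), inferInstance,
    fun π => (((a π, zeroMark (halfColouring M π (a π))), fun x => ⟨repr M (π.part x),
      π.part_subset _ (repr_mem (π.part_nonempty.2 (Finset.mem_sdiff.1 x.2).1))⟩),
      word (halfColouring M π (a π))), ?_, ?_, ?_⟩
  -- There are 2M cuts, M + 1 zero-marks and (2L)^(2(L - M)) choices of representatives; both 2M and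
  -- M + 1 are at most 2L.
  · rw [Fintype.card_prod, Fintype.card_prod, Fintype.card_option, Fintype.card_fin,
      Fintype.card_fin, Fintype.card_fun, Fintype.card_coe, Fintype.card_coe,
      card_sdiff_of_subset (signedSet_mono hML), card_signedSet, card_signedSet, ← Nat.mul_sub,
      add_comm (2 * (L - M)), pow_add, sq]
    refine Nat.mul_le_mul_right _ (Nat.mul_le_mul ?_ ?_) <;> omega
  · intro π hπ π' hπ' hΦ
    simp only [Prod.mk.injEq] at hΦ
    obtain ⟨⟨⟨h1, h2⟩, h3⟩, h4⟩ := hΦ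
    have hr : ∀ x ∈ signedSet L, x ∉ signedSet M → repr M (π.part x) = repr M (π'.part x) := by
      intro x hx hxM
      exact congrArg Subtype.val (congrFun h3 ⟨x, Finset.mem_sdiff.2 ⟨hx, hxM⟩⟩)
    have hcut := ha π hπ
    have hcut' := ha π' hπ'
    rw [← h1] at h2 h4 hcut'
    refine finpartition_ext fun x hx y hy => ⟨?_, ?_⟩
    · exact part_eq_of_encoding hM hML (hC π hπ) (hC π' hπ') hcut h4 h2 hr hx hy
    · exact part_eq_of_encoding hM hML (hC π' hπ') (hC π hπ) hcut' h4.symm h2.symm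
        (fun x hx hxM => (hr x hx hxM).symm) hx hy
  · intro π hπ
    refine ⟨(hC π hπ).word_mem_almostDivisible hM hML (ha π hπ), fun s hs => ⟨?_, ?_⟩⟩
    · exact (hC π hπ).numPairs_le hM hML (ha π hπ) s
    · exact (hC π hπ).le_numPairs hM hML (ha π hπ) hs

end Encoding

/-! ### Type A: the word of block sizes is an exact encoding -/

section TypeA

variable {k n : ℕ} {π : Finpartition (Finset.Icc (1 : ℤ) (k * n : ℕ))}

/-- The colouring of `0, …, kn - 1` by the blocks. -/
noncomputable def linearColouring (π : Finpartition (Finset.Icc (1 : ℤ) (k * n : ℕ))) (i : Fin (k * n)) :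
    Finset ℤ := π.part (i + 1 : ℤ)

lemma add_one_mem (i : Fin (k * n)) : (i + 1 : ℤ) ∈ Finset.Icc (1 : ℤ) (k * n : ℕ) := by
  have := i.2
  rw [mem_Icc]
  omega

lemma exists_add_one {x : ℤ} (hx : x ∈ Finset.Icc (1 : ℤ) (k * n : ℕ)) :
    ∃ i : Fin (k * n), x = (i + 1 : ℤ) := by
  rw [mem_Icc] at hx
  refine ⟨⟨(x - 1).toNat, by omega⟩, ?_⟩
  simp only [Int.toNat_of_nonneg (show 0 ≤ x - 1 by omega), sub_add_cancel]

lemma linearColouring_nc (hπ : NonCrossing Int.toNat π.parts) : IsNC (linearColouring π) := by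
  intro a b c d hab hbc hcd h1 h2
  have hmem : ∀ i : Fin (k * n), (i + 1 : ℤ) ∈ linearColouring π i := fun i =>
    π.mem_part_self.2 (add_one_mem i)
  have hab' : (a : ℕ) < b := hab
  have hbc' : (b : ℕ) < c := hbc
  have hcd' : (c : ℕ) < d := hcd
  exact hπ _ (π.part_mem.2 (add_one_mem a)) _ (π.part_mem.2 (add_one_mem b)) _ (hmem a) _ (hmem b)
    (c + 1 : ℤ) (h1.symm ▸ hmem c : (c + 1 : ℤ) ∈ linearColouring π a)
    (d + 1 : ℤ) (h2.symm ▸ hmem d : (d + 1 : ℤ) ∈ linearColouring π b) (by omega) (by omega) (by omega)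

lemma word_linearColouring {j : Fin (k * n)} (hj : first (linearColouring π) j = j) :
    word (linearColouring π) j = (linearColouring π j).card := by
  rw [word_eq_of_first _ hj]
  refine card_bij (fun i _ => (i + 1 : ℤ)) ?_ ?_ ?_
  · intro i hi
    rw [← (mem_filter.1 hi).2]
    exact π.mem_part_self.2 (add_one_mem i)
  · intro i _ i' _ h
    exact Fin.ext (by omega)
  · intro x hx
    obtain ⟨i, rfl⟩ := exists_add_one (π.part_subset _ hx)
    exact ⟨i, mem_filter.2 ⟨mem_univ _, π.part_eq_of_mem (π.part_mem.2 (add_one_mem j)) hx⟩, rfl⟩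

lemma count_linearColouring {s : ℕ} (hs : 0 < s) :
    count (word (linearColouring π)) s = numBlocks π s := by
  have hf : ∀ j, word (linearColouring π) j = s → first (linearColouring π) j = j :=
    fun j hj => (word_pos_iff _).1 (by omega)
  refine card_bij (fun j _ => linearColouring π j) ?_ ?_ ?_
  · intro j hj
    rw [mem_filter] at hj ⊢
    refine ⟨π.part_mem.2 (add_one_mem j), ?_⟩
    rw [← hj.2, word_linearColouring (hf j hj.2)]
  · intro i hi j hj hij
    rw [← hf i (mem_filter.1 hi).2, ← hf j (mem_filter.1 hj).2]
    exact (first_eq_iff _).2 hij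
  · intro V hV
    rw [mem_filter] at hV
    obtain ⟨x, hx⟩ := π.nonempty_of_mem_parts hV.1
    obtain ⟨i, rfl⟩ := exists_add_one (π.subset hV.1 hx)
    have h1 : linearColouring π (first (linearColouring π) i) = V :=
      (apply_first _ i).trans (π.part_eq_of_mem hV.1 hx)
    refine ⟨first (linearColouring π) i, mem_filter.2 ⟨mem_univ _, ?_⟩, h1⟩
    rw [word_linearColouring (first_first _ i), h1, hV.2]

lemma word_linearColouring_mem (hdvd : ∀ V ∈ π.parts, k ∣ V.card) :
    word (linearColouring π) ∈ almostDivisible k (k * n) 0 := by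
  rw [almostDivisible, mem_filter, mem_piAntidiag]
  refine ⟨⟨sum_word _, fun i _ => mem_univ i⟩, ?_⟩
  rw [Nat.le_zero, card_eq_zero, filter_eq_empty_iff]
  intro j _
  rw [not_not]
  rcases Nat.eq_zero_or_pos (word (linearColouring π) j) with h | h
  · rw [h]
    exact dvd_zero k
  · rw [word_linearColouring ((word_pos_iff _).1 h)]
    exact hdvd _ (π.part_mem.2 (add_one_mem j))

lemma injOn_word_linearColouring :
    Set.InjOn (fun π => word (linearColouring (k := k) (n := n) π)) (NCA k n) := by
  classical
  intro π hπ π' hπ' h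
  rw [mem_coe, NCA, mem_filter] at hπ hπ'
  refine finpartition_ext fun x hx y hy => ?_
  obtain ⟨i, rfl⟩ := exists_add_one hx
  obtain ⟨j, rfl⟩ := exists_add_one hy
  exact ker_eq_of_word_eq (linearColouring_nc hπ.2.1) (linearColouring_nc hπ'.2.1) h i j

theorem expectedBlocksA_isEquivalent {k t : ℕ} (hk : 0 < k) (ht : 0 < t) :
    (fun n : ℕ => expectedBlocksA k n (t * k)) ~[atTop]
      fun n : ℕ => (n : ℝ) * (k : ℝ) ^ 2 / ((k : ℝ) + 1) ^ (t + 1) := by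
  classical
  refine isEquivalent_of_encoding hk t (fun n => NCA k n) (fun n π => numBlocks π (t * k))
    0 0 0 0 1 0 ?_ (Eventually.of_forall fun n => card_ballotWords_le_NCA hk n)
  refine Eventually.of_forall fun n => ⟨Unit, inferInstance,
    fun π => ((), word (linearColouring π)), by simp, ?_, ?_⟩
  · intro π hπ π' hπ' h
    exact injOn_word_linearColouring hπ hπ' (Prod.mk.inj h).2
  · intro π hπ
    rw [NCA, mem_filter] at hπ
    have h1 : count (word (linearColouring π)) (t * k) = numBlocks π (t * k) :=
      count_linearColouring (Nat.mul_pos ht hk)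
    exact ⟨word_linearColouring_mem hπ.2.2, h1.ge, h1.le⟩

end TypeA

/-! ### Type B: encoding on the whole circle -/

section TypeB

lemma isSym_of_mem_NCB {k n : ℕ} (hM : 0 < k * n) {π : Finpartition (signedSet (k * n))}
    (hπ : π ∈ NCB k n) : IsSym k (k * n) π := by
  classical
  rw [NCB, mem_filter] at hπ
  obtain ⟨-, ⟨hnc, hneg, hzero⟩, hdvd⟩ := hπ
  exact ⟨hneg, hzero, liftNC_of_nonCrossing hM 0 (fun i => by rw [circlePos_lab hM, add_zero]) hnc,
    hdvd⟩

theorem expectedPairsB_isEquivalent {k t : ℕ} (hk : 0 < k) (ht : 0 < t) :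
    (fun n : ℕ => expectedPairsB k n (t * k)) ~[atTop]
      fun n : ℕ => (n : ℝ) * (k : ℝ) ^ 2 / ((k : ℝ) + 1) ^ (t + 1) := by
  -- Here M = L = kn: only the zero-block is exceptional, and the side data are the cut and the
  -- zero-mark.
  refine isEquivalent_of_encoding hk t (fun n => NCB k n) (fun n π => numPairs π (t * k))
    0 0 1 1 (2 * k) 2 ?_ (Eventually.of_forall fun n => card_ballotWords_le_NCB hk n)
  filter_upwards [eventually_gt_atTop 0] with n hn
  have hM : 0 < k * n := Nat.mul_pos hk hn
  obtain ⟨ι, hι, Φ, hcard, hinj, hΦ⟩ := exists_encoding hM le_rfl (NCB k n)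
    fun π hπ => isSym_of_mem_NCB hM hπ
  rw [Nat.sub_self, mul_zero, zero_add] at hcard
  refine ⟨ι, hι, Φ, hcard.trans (Nat.pow_le_pow_left ?_ _), hinj, fun π hπ => ?_⟩
  · rw [mul_assoc]
    exact Nat.mul_le_mul_left _ (Nat.mul_le_mul_left _ (Nat.le_succ n))
  · have h1 := hΦ π hπ
    rw [Nat.sub_self, mul_zero, zero_add] at h1
    exact ⟨h1.1, h1.2 _ (Nat.mul_pos ht hk)⟩

end TypeB

/-! ### Type D: encoding on the outer circle -/

section TypeD

lemma exists_isNext {pos : ℤ → ℕ} {V : Finset ℤ} {x : ℤ} (hx : x ∈ V) :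
    ∃ y, IsNext pos V x y := by
  by_cases h : (V.filter fun z => pos x < pos z).Nonempty
  · obtain ⟨y, hy, hmin⟩ := exists_min_image _ pos h
    rw [mem_filter] at hy
    refine ⟨y, hx, hy.1, Or.inl ⟨hy.2, fun z hz hzxy => ?_⟩⟩
    have := hmin z (mem_filter.2 ⟨hz, hzxy.1⟩)
    omega
  · obtain ⟨y, hy, hmin⟩ := exists_min_image V pos ⟨x, hx⟩
    refine ⟨y, hx, hy, Or.inr ⟨fun z hz => ?_, hmin⟩⟩
    by_contra hzx
    exact h ⟨z, mem_filter.2 ⟨hz, not_le.1 hzx⟩⟩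

lemma isNext_injective {pos : ℤ → ℕ} {V : Finset ℤ} (hinj : Set.InjOn pos V) {x x' y : ℤ}
    (h : IsNext pos V x y) (h' : IsNext pos V x' y) : x = x' := by
  obtain ⟨hx, -, h⟩ := h
  obtain ⟨hx', -, h'⟩ := h'
  refine hinj hx hx' ?_
  rcases h with ⟨h1, h2⟩ | ⟨h1, h2⟩ <;> rcases h' with ⟨h3, h4⟩ | ⟨h3, h4⟩
  · have h5 := h2 x' hx'
    have h6 := h4 x hx
    omega
  · have := h4 x hx
    omega
  · have := h2 x' hx'
    omega
  · exact le_antisymm (h3 x hx) (h1 x' hx')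

/-- A block whose elements increase by `1` modulo `k` along the cyclic order is
`k`-divisible. -/
lemma dvd_card_of_isNext {k : ℕ} {pos : ℤ → ℕ} {V : Finset ℤ} (hinj : Set.InjOn pos V)
    (h : ∀ x y, IsNext pos V x y → |y| ≡ |x| + 1 [ZMOD k]) : k ∣ V.card := by
  have hex : ∀ x, ∃ y, x ∈ V → IsNext pos V x y := by
    intro x
    by_cases hx : x ∈ V
    · obtain ⟨y, hy⟩ := exists_isNext (pos := pos) hx
      exact ⟨y, fun _ => hy⟩
    · exact ⟨x, fun h => absurd h hx⟩
  choose next hnext using hex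
  have hmaps : ∀ x ∈ V, next x ∈ V := fun x hx => (hnext x hx).2.1
  have hinjn : Set.InjOn next V := fun x hx x' hx' hxx =>
    isNext_injective hinj (hnext x hx) (hxx ▸ hnext x' hx')
  have himg : V.image next = V :=
    eq_of_subset_of_card_le (fun y hy => by
      obtain ⟨x, hx, rfl⟩ := mem_image.1 hy
      exact hmaps x hx) (card_image_of_injOn hinjn).ge
  have hsum : ∑ x ∈ V, |next x| = ∑ x ∈ V, |x| := by
    conv_rhs => rw [← himg, sum_image hinjn]
  -- The successor map permutes V, so the absolute values cancel and the sum is the number of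
  -- elements of V.
  have h1 : (k : ℤ) ∣ ∑ x ∈ V, (|x| + 1 - |next x|) :=
    dvd_sum fun x hx => (h x _ (hnext x hx)).dvd
  rw [sum_sub_distrib, sum_add_distrib, hsum, add_sub_cancel_left, sum_const, nsmul_eq_mul,
    mul_one] at h1
  exact_mod_cast h1

/-- A zero-block contains the whole inner circle, hence is unique. Restricting the cut annulus to
its outer circle leaves a rotated circular order, and condition (2) gives divisibility. -/
lemma isSym_of_mem_NCD {k n : ℕ} (hk : 0 < k) (hn : 1 < n) {π : Finpartition (signedSet (k * n))}
    (hπ : π ∈ NCD k n) : IsSym k (k * (n - 1)) π := by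
  classical
  rw [NCD, mem_filter] at hπ
  obtain ⟨-, ⟨a, b, hnc, hmod⟩, hneg, hzero, -⟩ := hπ
  have hM : 0 < k * (n - 1) := Nat.mul_pos hk (by omega)
  refine ⟨hneg, ?_, ?_, ?_⟩
  · intro V hV W hW hV0 hW0
    have hx : ((k * n : ℕ) : ℤ) ∈ innerSet k n := by
      have := mul_pred_add (k := k) (n := n) (by omega)
      rw [mem_innerSet]
      omega
    exact π.eq_of_mem_parts hV hW ((hzero V hV hV0).1 hx) ((hzero W hW hW0).1 hx)
  · refine liftNC_of_nonCrossing hM a (fun i => ?_) hnc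
    have hi : lab (k * (n - 1)) i ∈ outerSet k n := lab_mem hM i
    rw [cutPos, if_pos hi]
    push_cast
    have := circlePos_lab hM i
    push_cast at this
    rw [this, Int.emod_add_emod]
  · intro V hV
    exact dvd_card_of_isNext ((cutPos_injOn hk hn a b).mono (π.subset hV)) (hmod V hV)

theorem expectedPairsD_isEquivalent {k t : ℕ} (hk : 0 < k) (ht : 0 < t) :
    (fun n : ℕ => expectedPairsD k n (t * k)) ~[atTop]
      fun n : ℕ => (n : ℝ) * (k : ℝ) ^ 2 / ((k : ℝ) + 1) ^ (t + 1) := by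
  -- The outer circle has half-length k(n - 1) and the ballot words belong to n - 2, whence the
  -- shifts 1 and 2. The 2k inner labels and the zero-block give at most 2k + 1 exceptional blocks.
  refine isEquivalent_of_encoding hk t (fun n => NCD k n) (fun n π => numPairs π (t * k))
    1 2 (2 * k + 1) (2 * k + 1) (2 * k) (2 * k + 2) ?_ ?_
  · filter_upwards [eventually_gt_atTop 1] with n hn
    have hM : 0 < k * (n - 1) := Nat.mul_pos hk (by omega)
    have hML := mul_pred_add (k := k) (n := n) (by omega)
    obtain ⟨ι, hι, Φ, hcard, hinj, hΦ⟩ := exists_encoding hM (by omega) (NCD k n)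
      fun π hπ => isSym_of_mem_NCD hk hn hπ
    rw [show k * n - k * (n - 1) = k by omega] at hcard hΦ
    refine ⟨ι, hι, Φ, hcard.trans (Nat.pow_le_pow_left ?_ _), hinj, fun π hπ => ?_⟩
    · rw [mul_assoc]
      exact Nat.mul_le_mul_left _ (Nat.mul_le_mul_left _ (Nat.le_succ n))
    · exact ⟨(hΦ π hπ).1, (hΦ π hπ).2 _ (Nat.mul_pos ht hk)⟩
  · filter_upwards [eventually_gt_atTop 1] with n hn
    exact card_ballotWords_le_NCD hk hn

end TypeD

end NCWord

theorem mainTheorem8 (k t : ℕ) (hk : 1 ≤ k) (ht : 1 ≤ t) :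
    ((fun n : ℕ => expectedPairsB k n (t * k)) ~[atTop]
      fun n : ℕ => (n : ℝ) * (k : ℝ) ^ 2 / ((k : ℝ) + 1) ^ (t + 1)) ∧
    ((fun n : ℕ => expectedPairsD k n (t * k)) ~[atTop]
      fun n : ℕ => (n : ℝ) * (k : ℝ) ^ 2 / ((k : ℝ) + 1) ^ (t + 1)) ∧
    ((fun n : ℕ => expectedBlocksA k n (t * k)) ~[atTop]
      fun n : ℕ => (n : ℝ) * (k : ℝ) ^ 2 / ((k : ℝ) + 1) ^ (t + 1)) :=
  ⟨NCWord.expectedPairsB_isEquivalent hk ht, NCWord.expectedPairsD_isEquivalent hk ht,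
    NCWord.expectedBlocksA_isEquivalent hk ht⟩
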